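/- Let $A$ be a complex Banach algebra with unit ${\bf e}\neq 0$, ordered by a closed convex cone $A^+$ (with $A^+\cap(-A^+)=\{0\}$) such that ${\bf e}\in A^+$ and $A^+A^+\subseteq A^+$. Let ${\bf OI}(A)=\{p\in A: 0\le p\le{\bf e},\ p^2=p\}$ be the Boolean algebra of order idempotents, and put $p^{\rm d}={\bf e}-p$. A positive $a\in A$ is *order continuous* ($a\in A_{\rm n}$) if $p_\alpha a\downarrow 0$ and $ap_\alpha\downarrow 0$ in $A$ for every net $p_\alpha\downarrow 0$ in ${\bf OI}(A)$. A positive $a$ is *irreducible* if $p^{\rm d}ap=0$ with $p\in{\bf OI}(A)$ implies $p\in\{0,{\bf e}\}$. An element $b$ is *algebraically strictly positive*, $b\gg0$, if $p_1bp_2>0$ for all non-zero $p_1,p_2\in{\bf OI}(A)$; it is *relatively algebraically strictly positive* if there is a non-zero $q\in{\bf OI}(A)$ with $qbq=b$ and $q_1bq_2>0$ for all non-zero $q_1,q_2\in{\bf OI}(A)$ with $q_1,q_2\le q$. The set ${\cal F}(A)$ of *finite-rank elements* is the two-sided ideal generated by all relatively algebraically strictly positive order continuous idempotents (and $\emptyset$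 if there are none). Let $A_{\rm r}=A^+-A^+$, and for $b\in A^+$ let $A_b=\{y\in A:-\lambda b\le y\le\lambda b\text{ for some real }\lambda\ge0\}$. For $a\in A$, let $\sigma(a)$ be the spectrum, $r(a)$ the spectral radius, $R(\lambda,a)=(\lambda-a)^{-1}$ the resolvent, and $\sigma_{\rm per}(a)=\{\lambda\in\sigma(a):|\lambda|=r(a)\}$ the peripheral spectrum; if $r(a)$ is a pole of $R(\cdot,a)$, let $a_{-1}$ be the residue there. An element $a$ is *primitive* if $\sigma_{\rm per}(a)$ contains at most one point. Assume that $A$ satisfies the following axioms. - **(A$_1$)** $A_{\rm n}$ is closed under multiplication and is a closed subset of $A$; whenever $a,b\in A_{\rm n}$ and $ab=0$ there is $p\in{\bf OI}(A)$ with $ap=p^{\rm d}b=0$; the Boolean algebra ${\bf OI}(A)$ is Dedekind complete. - **(A$_2$)** Every idempotent $b\gg0$ of $A$ is minimal, i.e. $bAb={\Bbb C}b$. - **(A$_3$)** For every non-zero $b\in A^+$ the order ideal $A_b$ is lattice isomorphic to a space $C(K)$ of real continuous functions on a compact Hausdorff space $K$, with $b$ mapped to the constant function one. - **(A$_4$)**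 If $x+iy=0$ with $x,y\in A_{\rm r}$, then $x=y=0$. - **(A$_5$)** If $(b_n)$, $(c_n)$ are sequences in $A_{\rm r}$ and $(b_n+ic_n)$ converges, then $(b_n)$ and $(c_n)$ converge. - **(A$_{\rm LS}$)** If $a\in A^+$, $r(a)$ is a pole of $R(\cdot,a)$ and $a_{-1}\in{\cal F}(A)$, then $\sigma_{\rm per}(a)$ consists entirely of poles of $R(\cdot,a)$. Let $a\in A$ be a non-zero, order continuous, irreducible element such that $r(a)$ is a pole of $R(\cdot,a)$. Then $r(a)>0$, and the following statements are equivalent: (a) $a$ is primitive; (b) $a^m$ is primitive for all integers $m\ge1$; (c) $a^m$ is irreducible for all integers $m\ge1$; (d) the sequence $\big((a/r(a))^n\big)_{n}$ converges to an algebraically strictly positive element. -/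

import Mathlib

open Filter Topology

universe u

/-
Throughout, an ordered Banach algebra is a complex Banach algebra `A` (complete normed `ℂ`-algebra)
with unit `1 ≠ 0` and a partial order such that sums and products of positive elements are positive,
`0 ≤ 1`, non-negative real multiples of positive elements are positive (`IsOrderedRing A`,
`IsOrderedModule ℝ A`), and the positive cone is closed (`OrderClosedTopology A`).
-/

namespace OBA

section Spectral

variable {B : Type u} [NormedRing B] [NormedAlgebra ℂ B]

/-- The spectral radius `r(b)`, as a real number. -/
noncomputable def specRad (b : B) : ℝ := (spectralRadius ℂ b).toReal

/-- The peripheral spectrum: the points of the spectrum of modulus `r(b)`. -/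
def peripheralSpectrum (b : B) : Set ℂ := {z | z ∈ spectrum ℂ b ∧ ‖z‖ = specRad b}

/-- An element is primitive if its peripheral spectrum has at most one point. -/
def IsPrimitive (b : B) : Prop := (peripheralSpectrum b).Subsingleton

/-- `c : ℤ → B` is the family of coefficients of the Laurent expansion of the resolvent
`R(w, b) = (w - b)⁻¹` in a punctured neighbourhood of `z` that lies in the resolvent set. -/
def IsLaurentExpansion (b : B) (z : ℂ) (c : ℤ → B) : Prop :=
  ∃ ε : ℝ, 0 < ε ∧ ∀ w : ℂ, 0 < ‖w - z‖ → ‖w - z‖ < ε →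
    w ∈ resolventSet ℂ b ∧ HasSum (fun j : ℤ => (w - z) ^ j • c j) (resolvent b w)

/-- `z` is a pole of order `k ≥ 1` of the resolvent of `b`: it is an isolated point of the spectrum,
the Laurent coefficients of index `< -k` vanish, and the one of index `-k` does not. -/
def IsPoleOfOrder (b : B) (z : ℂ) (k : ℕ) : Prop :=
  0 < k ∧ z ∈ spectrum ℂ b ∧
    ∃ c : ℤ → B, IsLaurentExpansion b z c ∧ (∀ j : ℤ, j < -(k : ℤ) → c j = 0) ∧ c (-(k : ℤ)) ≠ 0

/-- `z` is a pole (of some order) of the resolvent of `b`. -/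
def IsPole (b : B) (z : ℂ) : Prop := ∃ k : ℕ, IsPoleOfOrder b z k

/-- `x` is the residue of the resolvent of `b` at `z`. -/
def IsResidue (b : B) (z : ℂ) (x : B) : Prop :=
  ∃ c : ℤ → B, IsLaurentExpansion b z c ∧ c (-1) = x

/-- A minimal idempotent: a non-zero idempotent `b` with `bBb = ℂb`. -/
def IsMinimalIdempotent (b : B) : Prop :=
  b * b = b ∧ b ≠ 0 ∧ ∀ x : B, ∃ t : ℂ, b * x * b = t • b

end Spectral

section Order

variable {A : Type u} [NormedRing A] [PartialOrder A]

variable (A) in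
/-- The order idempotents: `0 ≤ p ≤ 1` and `p² = p`. -/
def OI : Set A := {p | 0 ≤ p ∧ p ≤ 1 ∧ p * p = p}

/-- The net `x` decreases to `0` in `S`: it is a decreasing net in `S` whose infimum in `S` is `0`. -/
def DecreasesToZeroIn {ι : Type u} [Preorder ι] (S : Set A) (x : ι → A) : Prop :=
  Antitone x ∧ (∀ i, x i ∈ S) ∧ (∀ i, 0 ≤ x i) ∧ ∀ y ∈ S, (∀ i, y ≤ x i) → y ≤ 0

/-- Order continuous elements (the set `Aₙ`): positive elements `a` such that `p_i a ↓ 0` and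
`a p_i ↓ 0` in `A` whenever a net `p_i ↓ 0` in `OI(A)`. -/
def OrderContinuous (a : A) : Prop :=
  0 ≤ a ∧ ∀ (ι : Type u) [Preorder ι] [IsDirectedOrder ι] [Nonempty ι] (p : ι → A),
    DecreasesToZeroIn (OI A) p →
      DecreasesToZeroIn Set.univ (fun i => p i * a) ∧
      DecreasesToZeroIn Set.univ (fun i => a * p i)

/-- A positive element is irreducible if it has no non-trivial invariant order idempotent. -/
def IsIrreducible (a : A) : Prop :=
  0 ≤ a ∧ ∀ p ∈ OI A, (1 - p) * a * p = 0 → p = 0 ∨ p = 1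

/-- Algebraically strictly positive elements, `a ≫ 0`. -/
def AlgStrictlyPos (a : A) : Prop :=
  ∀ p₁ ∈ OI A, ∀ p₂ ∈ OI A, 0 < p₁ → 0 < p₂ → 0 < p₁ * a * p₂

/-- Relatively algebraically strictly positive elements: for some non-zero order idempotent `q`,
`b = qbq` and `q₁bq₂ > 0` for all non-zero order idempotents `q₁, q₂ ≤ q`. -/
def RelAlgStrictlyPos (b : A) : Prop :=
  ∃ q ∈ OI A, q ≠ 0 ∧ q * b * q = b ∧
    ∀ q₁ ∈ OI A, ∀ q₂ ∈ OI A, 0 < q₁ → q₁ ≤ q → 0 < q₂ → q₂ ≤ q → 0 < q₁ * b * q₂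

variable (A) in
/-- The relatively algebraically strictly positive, order continuous idempotents. -/
def basicProjectors : Set A := {b | b * b = b ∧ OrderContinuous b ∧ RelAlgStrictlyPos b}

variable (A) in
/-- The finite-rank elements: the two-sided ideal generated by the relatively algebraically
strictly positive order continuous idempotents, or the empty set if there are none. -/
def finiteRank : Set A :=
  {x | (basicProjectors A).Nonempty ∧ x ∈ TwoSidedIdeal.span (basicProjectors A)}

variable (A) in
/-- Axiom (A₁): `A` is order regular and has a disjunctive product, the Boolean algebra `OI(A)` is
Dedekind complete, and the set of order continuous elements is closed. -/
structure AxiomA1 : Prop where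
  order_regular : ∀ a b : A, OrderContinuous a → OrderContinuous b → OrderContinuous (a * b)
  disjunctive : ∀ a b : A, OrderContinuous a → OrderContinuous b → a * b = 0 →
    ∃ p ∈ OI A, a * p = 0 ∧ (1 - p) * b = 0
  dedekind_complete : ∀ S : Set (OI A), ∃ p : OI A, IsLUB S p
  closed : IsClosed {a : A | OrderContinuous a}

variable (A) in
/-- The regular elements, differences of two positive elements. -/
def regularElements : Set A := {x | ∃ y z : A, 0 ≤ y ∧ 0 ≤ z ∧ x = y - z}

variable [NormedAlgebra ℂ A]

variable (A) in
/-- Axiom (A₂): every algebraically strictly positive idempotent is minimal. -/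
def AxiomA2 : Prop := ∀ b : A, b * b = b → AlgStrictlyPos b → IsMinimalIdempotent b

/-- The order ideal `A_b` generated by `b`, a real linear space:
all `y` with `-tb ≤ y ≤ tb` for some real `t ≥ 0`. -/
def orderIdeal [IsOrderedRing A] [IsOrderedModule ℝ A] (b : A) : Submodule ℝ A where
  carrier := {y | ∃ t : ℝ, 0 ≤ t ∧ -(t • b) ≤ y ∧ y ≤ t • b}
  zero_mem' := ⟨0, le_rfl, by simp, by simp⟩
  add_mem' := by
    rintro x y ⟨s, hs, hs1, hs2⟩ ⟨t, ht, ht1, ht2⟩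
    refine ⟨s + t, add_nonneg hs ht, ?_, ?_⟩
    · rw [add_smul, neg_add]; exact add_le_add hs1 ht1
    · rw [add_smul]; exact add_le_add hs2 ht2
  smul_mem' := by
    rintro c x ⟨t, ht, h1, h2⟩
    rcases le_total 0 c with hc | hc
    · refine ⟨c * t, mul_nonneg hc ht, ?_, ?_⟩
      · have := smul_le_smul_of_nonneg_left h1 hc
        rwa [smul_neg, smul_smul] at this
      · have := smul_le_smul_of_nonneg_left h2 hc
        rwa [smul_smul] at this
    · have hc' : 0 ≤ -c := neg_nonneg.2 hc
      refine ⟨-c * t, mul_nonneg hc' ht, ?_, ?_⟩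
      · have := smul_le_smul_of_nonneg_left h2 hc'
        rw [smul_smul, neg_smul c x] at this
        simpa using neg_le_neg this
      · have := smul_le_smul_of_nonneg_left h1 hc'
        rw [smul_neg, smul_smul, neg_smul c x] at this
        simpa using neg_le_neg this

variable (A) in
/-- Axiom (A₃): for every non-zero `b ≥ 0` the order ideal `A_b` is isomorphic, as an ordered real
linear space (hence as a lattice), to some `C(K)` with `K` compact Hausdorff, and `b` corresponds
to the constant function `1`. -/
def AxiomA3 [IsOrderedRing A] [IsOrderedModule ℝ A] : Prop :=
  ∀ b : A, 0 ≤ b → b ≠ 0 →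
    ∃ (K : Type u) (_ : TopologicalSpace K) (_ : CompactSpace K) (_ : T2Space K)
      (φ : orderIdeal b ≃ₗ[ℝ] C(K, ℝ)),
      (∀ x y : orderIdeal b, φ x ≤ φ y ↔ x ≤ y) ∧ ((φ.symm 1 : orderIdeal b) : A) = b

variable (A) in
/-- Axiom (A₄): `a + ib = 0` with regular `a, b` implies `a = b = 0`. -/
def AxiomA4 : Prop :=
  ∀ a ∈ regularElements A, ∀ b ∈ regularElements A, a + Complex.I • b = 0 → a = 0 ∧ b = 0

variable (A) in
/-- Axiom (A₅): if `bₙ + i cₙ` converges, with regular `bₙ, cₙ`, then `bₙ` and `cₙ` converge. -/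
def AxiomA5 : Prop :=
  ∀ b c : ℕ → A, (∀ n, b n ∈ regularElements A) → (∀ n, c n ∈ regularElements A) →
    (∃ L : A, Tendsto (fun n => b n + Complex.I • c n) atTop (𝓝 L)) →
      (∃ L : A, Tendsto b atTop (𝓝 L)) ∧ ∃ L : A, Tendsto c atTop (𝓝 L)

variable (A) in
/-- The Lotz-Schaefer axiom: if `a ≥ 0`, `r(a)` is a pole of the resolvent of `a`, and the residue
there is a finite-rank element, then the peripheral spectrum of `a` consists of poles. -/
def AxiomLS : Prop :=
  ∀ a : A, 0 ≤ a → IsPole a (specRad a : ℂ) →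
    (∃ x ∈ finiteRank A, IsResidue a (specRad a : ℂ) x) →
      ∀ z ∈ peripheralSpectrum a, IsPole a z

end Order

end OBA

/-! This is Perron–Frobenius theory. If `r(a) = 0`, the pole at `0` would make `a` nilpotent, which
irreducibility and the disjunctive product exclude. So put `b = a / r(a)`.

Everything rests on the Abel means `ω(t - 1)R(ωt, b)` as `t ↓ 1`. At `ω = 1` they are positive
combinations of powers of `b`, so the leading Laurent coefficient `d` at `1` is positive and order
continuous. It satisfies `bd = db = d`, and irreducibility then gives `d ≫ 0`
(`algStrictlyPos_of_fixed`). Hence `d² ≠ 0`, so the pole is simple, and the residue `c` is an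
idempotent, minimal by (A₂) and of finite rank. By (A_LS) the peripheral spectrum consists of poles,
hence is finite.

If `1` is the only peripheral point, then `b - c` has spectral radius below `1`, so `bⁿ = c + (b -
c)ⁿ → c ≫ 0`. Conversely, a limit `L ≫ 0` of `bⁿ` rules out other peripheral points and invariant
idempotents of every power.

The hard implication is from irreducible powers to primitivity. The Abel means at a peripheral `ω`
are dominated by those at `1`; so the pole at `ω` is simple, and its residue is `x + iy` with `x, y`
in `A_c ≅ C(K)`. Multiplication by `b` becomes a Markov operator there. By Jensen's inequality `x² +
y²` (product of `C(K)`) increases under multiplication by `b` from either side. Cancellation against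
`c` and minimality of `c` make it constant, so `(x + iy)²` is an eigenvector for `ω²`
(`IsPerronResidue.sq_mem_spectrum`). Finiteness then makes `ω` a root of unity, of order `h` say. If
`ω ≠ 1`, the sum of the residues at all `ωⁱ`, `i < h`, is a positive idempotent fixed by the
irreducible `bʰ`, hence minimal. Yet it contains the orthogonal non-zero residues at `1` and `ω`, a
contradiction. -/

set_option linter.unusedSectionVars false

namespace OBA

/-! ### The Boolean algebra of order idempotents -/

section OrderIdempotents

variable {A : Type u} [NormedRing A] [PartialOrder A] [IsOrderedRing A]

theorem zero_mem_OI : (0 : A) ∈ OI A := ⟨le_rfl, zero_le_one, by simp⟩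

theorem one_mem_OI : (1 : A) ∈ OI A := ⟨zero_le_one, le_rfl, by simp⟩

theorem one_sub_mem_OI {p : A} (hp : p ∈ OI A) : 1 - p ∈ OI A := by
  obtain ⟨h0, h1, h2⟩ := hp
  refine ⟨sub_nonneg.2 h1, sub_le_self _ h0, ?_⟩
  rw [sub_mul, mul_sub, mul_sub, h2]; simp

/-- Order idempotents commute. -/
theorem OI_mul_comm {p q : A} (hp : p ∈ OI A) (hq : q ∈ OI A) : p * q = q * p := by
  obtain ⟨hp0, hp1, hp2⟩ := hp
  obtain ⟨hq0, hq1, hq2⟩ := hq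
  have hd : 0 ≤ 1 - p := sub_nonneg.2 hp1
  -- Since `q ≤ 1`, both off-diagonal corners of `q` are dominated by `p(1 - p) = 0`; hence `pq =
  -- pqp = qp`.
  have e1 : p * q * (1 - p) = 0 := by
    apply le_antisymm _ (mul_nonneg (mul_nonneg hp0 hq0) hd)
    calc p * q * (1 - p) ≤ p * 1 * (1 - p) := by gcongr
      _ = 0 := by rw [mul_one, mul_sub, hp2, mul_one, sub_self]
  have e2 : (1 - p) * q * p = 0 := by
    apply le_antisymm _ (mul_nonneg (mul_nonneg hd hq0) hp0)
    calc (1 - p) * q * p ≤ (1 - p) * 1 * p := by gcongr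
      _ = 0 := by rw [mul_one, sub_mul, hp2, one_mul, sub_self]
  rw [mul_sub, mul_one, sub_eq_zero] at e1
  rw [sub_mul, sub_mul, one_mul, sub_eq_zero] at e2
  rw [e1, e2]

theorem mul_mem_OI {p q : A} (hp : p ∈ OI A) (hq : q ∈ OI A) : p * q ∈ OI A := by
  have hc := OI_mul_comm hp hq
  refine ⟨mul_nonneg hp.1 hq.1, mul_le_one₀ hp.2.1 hq.1 hq.2.1, ?_⟩
  calc p * q * (p * q) = p * (q * p) * q := by noncomm_ring
    _ = p * p * (q * q) := by rw [← hc]; noncomm_ring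
    _ = p * q := by rw [hp.2.2, hq.2.2]

/-- The supremum of two order idempotents. -/
theorem exists_sup_OI {p q : A} (hp : p ∈ OI A) (hq : q ∈ OI A) :
    ∃ s ∈ OI A, p ≤ s ∧ q ≤ s ∧ 1 - s = (1 - p) * (1 - q) := by
  have hm := mul_mem_OI (one_sub_mem_OI hp) (one_sub_mem_OI hq)
  refine ⟨1 - (1 - p) * (1 - q), one_sub_mem_OI hm, ?_, ?_, by simp⟩
  · have : (1 - p) * (1 - q) ≤ (1 - p) * 1 :=
      mul_le_mul_of_nonneg_left (one_sub_mem_OI hq).2.1 (one_sub_mem_OI hp).1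
    rw [mul_one] at this
    rw [le_sub_comm]; exact this
  · have : (1 - p) * (1 - q) ≤ 1 * (1 - q) :=
      mul_le_mul_of_nonneg_right (one_sub_mem_OI hp).2.1 (one_sub_mem_OI hq).1
    rw [one_mul] at this
    rw [le_sub_comm]; exact this

theorem OI_mul_eq_of_le {p q : A} (hp : p ∈ OI A) (hq : q ∈ OI A) (h : q ≤ p) : q * p = q := by
  have h0 := mul_le_mul_of_nonneg_right h (one_sub_mem_OI hp).1
  have h1 : p * (1 - p) = 0 := by rw [mul_sub, hp.2.2, mul_one, sub_self]
  have h2 : q * (1 - p) = 0 :=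
    le_antisymm (h1 ▸ h0) (mul_nonneg hq.1 (one_sub_mem_OI hp).1)
  rw [mul_sub, mul_one, sub_eq_zero] at h2
  exact h2.symm

theorem sub_mem_OI {p q : A} (hp : p ∈ OI A) (hq : q ∈ OI A) (h : q ≤ p) : p - q ∈ OI A := by
  have : p - q = p * (1 - q) := by
    rw [mul_sub, mul_one, OI_mul_comm hp hq, OI_mul_eq_of_le hp hq h]
  rw [this]; exact mul_mem_OI hp (one_sub_mem_OI hq)

end OrderIdempotents

/-! ### Stability of order continuity -/

section OrderContinuity

variable {A : Type u} [NormedRing A] [PartialOrder A] [IsOrderedRing A]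

/-- If `z` is a lower bound of the sums, directedness gives `z ≤ x i + y j` for independent `i` and
`j`, so the two infima can be taken one after the other. -/
theorem DecreasesToZeroIn.add {ι : Type u} [Preorder ι] [IsDirectedOrder ι] {x y : ι → A}
    (hx : DecreasesToZeroIn Set.univ x) (hy : DecreasesToZeroIn Set.univ y) :
    DecreasesToZeroIn Set.univ (fun i => x i + y i) := by
  refine ⟨hx.1.add hy.1, fun _ => trivial, fun i => add_nonneg (hx.2.2.1 i) (hy.2.2.1 i),
    fun z _ hz => ?_⟩
  apply hx.2.2.2 z trivial
  intro i
  rw [← sub_nonpos]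
  apply hy.2.2.2 _ trivial
  intro j
  obtain ⟨k, hik, hjk⟩ := exists_ge_ge i j
  have h1 := hz k
  have h2 := hx.1 hik
  have h3 := hy.1 hjk
  rw [sub_le_iff_le_add]
  calc z ≤ x k + y k := h1
    _ ≤ x i + y j := add_le_add h2 h3
    _ = y j + x i := add_comm _ _

theorem OrderContinuous.add {a b : A} (ha : OrderContinuous a) (hb : OrderContinuous b) :
    OrderContinuous (a + b) := by
  refine ⟨add_nonneg ha.1 hb.1, fun ι _ _ _ p hp => ?_⟩
  simp only [mul_add, add_mul]
  exact ⟨(ha.2 ι p hp).1.add (hb.2 ι p hp).1, (ha.2 ι p hp).2.add (hb.2 ι p hp).2⟩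

theorem OrderContinuous.zero : OrderContinuous (0 : A) := by
  refine ⟨le_rfl, fun ι _ _ _ p hp => ?_⟩
  simp only [mul_zero, zero_mul]
  have : DecreasesToZeroIn (Set.univ : Set A) (fun _ : ι => (0 : A)) :=
    ⟨antitone_const, fun _ => trivial, fun _ => le_rfl,
      fun y _ h => h (Classical.arbitrary ι)⟩
  exact ⟨this, this⟩

theorem OrderContinuous.sum {ι : Type*} (s : Finset ι) (f : ι → A)
    (h : ∀ i ∈ s, OrderContinuous (f i)) : OrderContinuous (∑ i ∈ s, f i) := by
  classical
  induction s using Finset.induction_on with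
  | empty => simpa using OrderContinuous.zero
  | insert i s hi ih =>
    rw [Finset.sum_insert hi]
    exact (h i (by simp)).add (ih fun j hj => h j (by simp [hj]))

variable [NormedAlgebra ℂ A] [IsOrderedModule ℝ A]

/-- Order continuity passes to positive elements dominated by a multiple. -/
theorem OrderContinuous.of_le {c w : A} (hc : OrderContinuous c) {t : ℝ} (ht : 0 < t)
    (h0 : 0 ≤ w) (h : w ≤ t • c) : OrderContinuous w := by
  refine ⟨h0, fun ι _ _ _ p hp => ?_⟩
  obtain ⟨h1, h2⟩ := hc.2 ι p hp
  have key : ∀ x : ι → A, ∀ z : A, DecreasesToZeroIn Set.univ x → (∀ i, z ≤ t • x i) → z ≤ 0 := by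
    intro x z hx hz
    have : t⁻¹ • z ≤ 0 := by
      apply hx.2.2.2 _ trivial
      intro i
      have := smul_le_smul_of_nonneg_left (hz i) (inv_nonneg.2 ht.le)
      rwa [smul_smul, inv_mul_cancel₀ ht.ne', one_smul] at this
    have := smul_le_smul_of_nonneg_left this ht.le
    rwa [smul_smul, mul_inv_cancel₀ ht.ne', one_smul, smul_zero] at this
  refine ⟨⟨fun i j hij => mul_le_mul_of_nonneg_right (hp.1 hij) h0, fun _ => trivial,
    fun i => mul_nonneg (hp.2.2.1 i) h0, fun z _ hz => key _ z h1 fun i => ?_⟩,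
    ⟨fun i j hij => mul_le_mul_of_nonneg_left (hp.1 hij) h0, fun _ => trivial,
    fun i => mul_nonneg h0 (hp.2.2.1 i), fun z _ hz => key _ z h2 fun i => ?_⟩⟩
  · rw [← mul_smul_comm]
    exact (hz i).trans (mul_le_mul_of_nonneg_left h (hp.2.2.1 i))
  · rw [← smul_mul_assoc]
    exact (hz i).trans (mul_le_mul_of_nonneg_right h (hp.2.2.1 i))

theorem OrderContinuous.smul {c : A} (hc : OrderContinuous c) {t : ℝ} (ht : 0 ≤ t) :
    OrderContinuous (t • c) := by
  refine hc.of_le (t := t + 1) (by linarith) (smul_nonneg ht hc.1) ?_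
  exact smul_le_smul_of_nonneg_right (by linarith) hc.1

theorem OrderContinuous.OI_mul {c p : A} (hc : OrderContinuous c) (hp : p ∈ OI A) :
    OrderContinuous (p * c) := by
  refine hc.of_le one_pos (mul_nonneg hp.1 hc.1) ?_
  simpa using mul_le_mul_of_nonneg_right hp.2.1 hc.1

theorem OrderContinuous.mul_OI {c p : A} (hc : OrderContinuous c) (hp : p ∈ OI A) :
    OrderContinuous (c * p) := by
  refine hc.of_le one_pos (mul_nonneg hc.1 hp.1) ?_
  simpa using mul_le_mul_of_nonneg_left hp.2.1 hc.1

theorem OrderContinuous.pow (h1 : AxiomA1 A) {a : A} (ha : OrderContinuous a) {n : ℕ}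
    (hn : n ≠ 0) : OrderContinuous (a ^ n) := by
  obtain ⟨n, rfl⟩ := Nat.exists_eq_succ_of_ne_zero hn
  induction n with
  | zero => simpa using ha
  | succ n ih => rw [pow_succ]; exact h1.order_regular _ _ (ih (by simp)) ha

end OrderContinuity

/-! ### Annihilators, irreducibility and cancellation -/

section Annihilators

variable {A : Type u} [NormedRing A] [PartialOrder A] [IsOrderedRing A]

/-- A family of order idempotents, closed under finite suprema, admits a supremum `p` such that the
differences to `p` form a net decreasing to zero. -/
theorem exists_sup_decreasesToZeroIn (h1 : AxiomA1 A) (S : Set A) (hS : S ⊆ OI A) (h0 : (0 : A) ∈ S)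
    (hsup : ∀ p ∈ S, ∀ q ∈ S, ∃ s ∈ S, p ≤ s ∧ q ≤ s) :
    ∃ p ∈ OI A, (∀ q ∈ S, q ≤ p) ∧ Nonempty S ∧ IsDirectedOrder S ∧
      DecreasesToZeroIn (OI A) (fun q : S => p - (q : A)) := by
  obtain ⟨p, hp⟩ := h1.dedekind_complete {q | (q : A) ∈ S}
  have hub : ∀ q ∈ S, q ≤ (p : A) := fun q hq =>
    hp.1 (show (⟨q, hS hq⟩ : OI A) ∈ {q : OI A | (q : A) ∈ S} from hq)
  refine ⟨p, p.2, hub, ⟨⟨0, h0⟩⟩, ⟨fun q q' => ?_⟩,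
    ⟨fun q q' h => ?_, fun q => ?_, fun q => ?_, fun y hy h => ?_⟩⟩
  · obtain ⟨s, hs, h, h'⟩ := hsup q q.2 q' q'.2
    exact ⟨⟨s, hs⟩, h, h'⟩
  · exact sub_le_sub_left (Subtype.coe_le_coe.2 h) _
  · exact sub_mem_OI p.2 (hS q.2) (hub q q.2)
  · exact sub_nonneg.2 (hub q q.2)
  · have hyp : y ≤ p := by simpa using h ⟨0, h0⟩
    -- A lower bound `y` of all `p - q` makes `p - y` another upper bound of `S`, so `p ≤ p - y`.
    have : p ≤ ⟨(p : A) - y, sub_mem_OI p.2 hy hyp⟩ := by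
      apply hp.2
      intro q hq
      have := h ⟨q, hq⟩
      exact le_sub_comm.1 this
    have h' : (p : A) ≤ p - y := this
    simpa using h'

/-- The largest order idempotent annihilating an order continuous element from the left. -/
theorem exists_greatest_left_annihilator (h1 : AxiomA1 A) {b : A} (hb : OrderContinuous b) :
    ∃ p ∈ OI A, p * b = 0 ∧ ∀ q ∈ OI A, q * b = 0 → q ≤ p := by
  obtain ⟨p, hp, hub, hne, hdir, hdec⟩ := exists_sup_decreasesToZeroIn h1 {q | q ∈ OI A ∧ q * b = 0}
    (fun _ h => h.1) ⟨zero_mem_OI, zero_mul _⟩ (fun p hp q hq => by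
      obtain ⟨s, hs, h, h', e⟩ := exists_sup_OI hp.1 hq.1
      refine ⟨s, ⟨hs, ?_⟩, h, h'⟩
      have e' : (1 - s) * b = b := by
        rw [e, mul_assoc, sub_mul 1 q, hq.2, one_mul, sub_zero, sub_mul, hp.2, one_mul, sub_zero]
      rwa [sub_mul, one_mul, sub_eq_self] at e')
  refine ⟨p, hp, le_antisymm ?_ (mul_nonneg hp.1 hb.1), fun q hq h => hub q ⟨hq, h⟩⟩
  -- Since `qb = 0`, the element `pb` equals every `(p - q)b`, and these decrease to zero.
  refine (hb.2 _ _ hdec).1.2.2.2 _ trivial fun q => ?_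
  simp only [sub_mul, q.2.2, sub_zero, le_refl]

/-- The largest order idempotent annihilating an order continuous element from the right. -/
theorem exists_greatest_right_annihilator (h1 : AxiomA1 A) {b : A} (hb : OrderContinuous b) :
    ∃ p ∈ OI A, b * p = 0 ∧ ∀ q ∈ OI A, b * q = 0 → q ≤ p := by
  obtain ⟨p, hp, hub, hne, hdir, hdec⟩ := exists_sup_decreasesToZeroIn h1 {q | q ∈ OI A ∧ b * q = 0}
    (fun _ h => h.1) ⟨zero_mem_OI, mul_zero _⟩ (fun p hp q hq => by
      obtain ⟨s, hs, h, h', e⟩ := exists_sup_OI hp.1 hq.1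
      refine ⟨s, ⟨hs, ?_⟩, h, h'⟩
      have e' : b * (1 - s) = b := by
        rw [e, ← mul_assoc, mul_sub b 1 p, hp.2, mul_one, sub_zero, mul_sub, hq.2, mul_one,
          sub_zero]
      rwa [mul_sub, mul_one, sub_eq_self] at e')
  refine ⟨p, hp, le_antisymm ?_ (mul_nonneg hb.1 hp.1), fun q hq h => hub q ⟨hq, h⟩⟩
  refine (hb.2 _ _ hdec).2.2.2.2 _ trivial fun q => ?_
  simp only [mul_sub, q.2.2, sub_zero, le_refl]

variable [NormedAlgebra ℂ A] [IsOrderedModule ℝ A]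

/-- Let `m` be the greatest left annihilator of `y`. From `(mx)y = my = 0` the disjunctive product
yields `q` with `mxq = 0` and `(1 - q)y = 0`. Maximality gives `1 - m ≤ q`, so `mx(1 - m) = 0`, and
irreducibility forces `m = 0` because `y ≠ 0`. -/
theorem left_annihilator_eq_zero (h1 : AxiomA1 A) {x y : A} (hx : OrderContinuous x)
    (hxi : IsIrreducible x) (hy : OrderContinuous y) (hy0 : y ≠ 0) (hxy : x * y = y) {p : A}
    (hp : p ∈ OI A) (hpy : p * y = 0) : p = 0 := by
  obtain ⟨m, hm, hmy, hmax⟩ := exists_greatest_left_annihilator h1 hy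
  obtain ⟨q, hq, e1, e2⟩ := h1.disjunctive (m * x) y (hx.OI_mul hm) hy (by
    rw [mul_assoc, hxy, hmy])
  have hle := hmax _ (one_sub_mem_OI hq) e2
  have e3 : (1 - m) = q * (1 - m) := by
    rw [OI_mul_comm hq (one_sub_mem_OI hm), OI_mul_eq_of_le hq (one_sub_mem_OI hm)]
    exact sub_le_comm.1 hle
  have e4 : (1 - (1 - m)) * x * (1 - m) = 0 := by
    rw [sub_sub_cancel, e3, ← mul_assoc, e1, zero_mul]
  rcases hxi.2 _ (one_sub_mem_OI hm) e4 with h | h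
  · rw [sub_eq_zero] at h
    rw [← h, one_mul] at hmy
    exact absurd hmy hy0
  · rw [sub_eq_self] at h
    exact le_antisymm (h ▸ hmax p hp hpy) hp.1

theorem right_annihilator_eq_zero (h1 : AxiomA1 A) {x y : A} (hx : OrderContinuous x)
    (hxi : IsIrreducible x) (hy : OrderContinuous y) (hy0 : y ≠ 0) (hyx : y * x = y) {p : A}
    (hp : p ∈ OI A) (hyp : y * p = 0) : p = 0 := by
  obtain ⟨m, hm, hym, hmax⟩ := exists_greatest_right_annihilator h1 hy
  obtain ⟨q, hq, e1, e2⟩ := h1.disjunctive y (x * m) hy (hx.mul_OI hm) (by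
    rw [← mul_assoc, hyx, hym])
  have hle := hmax _ hq e1
  have e3 : (1 - m) = (1 - m) * (1 - q) := by
    rw [OI_mul_eq_of_le (one_sub_mem_OI hq) (one_sub_mem_OI hm)]
    exact sub_le_sub_left hle _
  have e4 : (1 - m) * x * m = 0 := by
    rw [e3, mul_assoc, mul_assoc, e2, mul_zero]
  rcases hxi.2 _ hm e4 with h | h
  · exact le_antisymm (h ▸ hmax p hp hyp) hp.1
  · rw [h, mul_one] at hym
    exact absurd hym hy0

/-- A non-zero order continuous element fixed by left and right multiplication with an irreducible
order continuous element is algebraically strictly positive. -/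
theorem algStrictlyPos_of_fixed (h1 : AxiomA1 A) {x y : A} (hx : OrderContinuous x)
    (hxi : IsIrreducible x) (hy : OrderContinuous y) (hy0 : y ≠ 0) (hxy : x * y = y)
    (hyx : y * x = y) : AlgStrictlyPos y := by
  intro p hp q hq hp0 hq0
  refine lt_of_le_of_ne (mul_nonneg (mul_nonneg hp.1 hy.1) hq.1) fun h => ?_
  by_cases hyq : y * q = 0
  · exact hq0.ne' (right_annihilator_eq_zero h1 hx hxi hy hy0 hyx hq hyq)
  -- Right multiplication by `q` keeps `y` fixed under `x` from the left, so the annihilator lemma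
  -- applies to `yq`.
  · refine hp0.ne' (left_annihilator_eq_zero h1 hx hxi (hy.mul_OI hq) hyq ?_ hp ?_)
    · rw [← mul_assoc, hxy]
    · rw [← mul_assoc, ← h]

/-- A non-zero irreducible order continuous element is not nilpotent. -/
theorem pow_ne_zero_of_irreducible (h1 : AxiomA1 A) [Nontrivial A] {x : A}
    (hx : OrderContinuous x) (hxi : IsIrreducible x) (hx0 : x ≠ 0) (n : ℕ) : x ^ n ≠ 0 := by
  induction n with
  | zero => simp
  | succ n ih =>
    rcases Nat.eq_zero_or_pos n with rfl | hn
    · simpa using hx0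
    intro h
    rw [pow_succ] at h
    obtain ⟨p, hp, e1, e2⟩ := h1.disjunctive _ _ (hx.pow h1 hn.ne') hx h
    -- `(1 - p)x = 0` makes `p` invariant; `p = 0` would kill `x` and `p = 1` would kill `xⁿ`.
    rcases hxi.2 p hp (by rw [e2, zero_mul]) with rfl | rfl
    · apply hx0; simpa using e2
    · apply ih; simpa using e1

/-- A disjunctive idempotent `p` satisfies `cp = 0`, which strict positivity allows only for `p =
0`. This cancellation later turns inequalities into equalities. -/
theorem eq_zero_of_mul_eq_zero_left (h1 : AxiomA1 A) {c w : A} (hc : OrderContinuous c)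
    (hcp : AlgStrictlyPos c) (hw : OrderContinuous w) (h : c * w = 0) : w = 0 := by
  obtain ⟨p, hp, e1, e2⟩ := h1.disjunctive _ _ hc hw h
  by_cases hp0 : p = 0
  · simpa [hp0] using e2
  · have hpp := lt_of_le_of_ne hp.1 (Ne.symm hp0)
    have := hcp 1 one_mem_OI p hp (hpp.trans_le hp.2.1) hpp
    rw [one_mul, e1] at this
    exact absurd this (lt_irrefl _)

theorem eq_zero_of_mul_eq_zero_right (h1 : AxiomA1 A) {c w : A} (hc : OrderContinuous c)
    (hcp : AlgStrictlyPos c) (hw : OrderContinuous w) (h : w * c = 0) : w = 0 := by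
  obtain ⟨p, hp, e1, e2⟩ := h1.disjunctive _ _ hw hc h
  by_cases hp0 : 1 - p = 0
  · rw [sub_eq_zero] at hp0
    simpa [← hp0] using e1
  · have hp' := one_sub_mem_OI hp
    have hpp := lt_of_le_of_ne hp'.1 (Ne.symm hp0)
    have := hcp _ hp' 1 one_mem_OI hpp (hpp.trans_le hp'.2.1)
    rw [mul_one, e2] at this
    exact absurd this (lt_irrefl _)

end Annihilators

/-! ### Resolvents, Neumann series and Laurent expansions -/

section SpectralTheory

variable {B : Type u} [NormedRing B] [NormedAlgebra ℂ B]

theorem mul_resolvent {b : B} {w : ℂ} (hw : w ∈ resolventSet ℂ b) :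
    b * resolvent b w = w • resolvent b w - 1 := by
  have := Ring.mul_inverse_cancel _ hw
  rw [sub_mul, ← Algebra.smul_def] at this
  rw [resolvent, ← this]; abel

theorem resolvent_mul {b : B} {w : ℂ} (hw : w ∈ resolventSet ℂ b) :
    resolvent b w * b = w • resolvent b w - 1 := by
  have := Ring.inverse_mul_cancel _ hw
  rw [mul_sub, ← Algebra.commutes, ← Algebra.smul_def] at this
  rw [resolvent, ← this]; abel

theorem resolvent_mul_of_mul_eq_smul {b z : B} {w ξ : ℂ} (hw : w ∈ resolventSet ℂ b)
    (hwξ : w ≠ ξ) (h : b * z = ξ • z) : resolvent b w * z = (w - ξ)⁻¹ • z := by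
  have h1 : resolvent b w * b * z = ξ • (resolvent b w * z) := by
    rw [mul_assoc, h, mul_smul_comm]
  rw [resolvent_mul hw, sub_mul, one_mul, smul_mul_assoc] at h1
  rw [eq_inv_smul_iff₀ (sub_ne_zero.2 hwξ), sub_smul, ← h1]; abel

theorem mul_resolvent_of_mul_eq_smul {b z : B} {w ξ : ℂ} (hw : w ∈ resolventSet ℂ b)
    (hwξ : w ≠ ξ) (h : z * b = ξ • z) : z * resolvent b w = (w - ξ)⁻¹ • z := by
  have h1 : z * (b * resolvent b w) = ξ • (z * resolvent b w) := by
    rw [← mul_assoc, h, smul_mul_assoc]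
  rw [mul_resolvent hw, mul_sub, mul_one, mul_smul_comm] at h1
  rw [eq_inv_smul_iff₀ (sub_ne_zero.2 hwξ), sub_smul, ← h1]; abel

variable [CompleteSpace B]

theorem spectralRadius_ne_top (b : B) : spectralRadius ℂ b ≠ ⊤ := by
  refine ne_top_of_le_ne_top ?_ (spectrum.spectralRadius_le_pow_nnnorm_pow_one_div ℂ b 0)
  simp [ENNReal.mul_eq_top]

theorem ofReal_specRad (b : B) : ENNReal.ofReal (specRad b) = spectralRadius ℂ b :=
  ENNReal.ofReal_toReal (spectralRadius_ne_top b)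

theorem specRad_nonneg (b : B) : 0 ≤ specRad b := ENNReal.toReal_nonneg

theorem norm_le_specRad {b : B} {z : ℂ} (hz : z ∈ spectrum ℂ b) : ‖z‖ ≤ specRad b := by
  have h : (‖z‖₊ : ENNReal) ≤ spectralRadius ℂ b := le_iSup₂ (f := fun k (_ : k ∈ spectrum ℂ b) =>
    (‖k‖₊ : ENNReal)) z hz
  have := ENNReal.toReal_mono (spectralRadius_ne_top b) h
  simpa [specRad] using this

theorem exists_norm_eq_specRad [Nontrivial B] (b : B) : ∃ z ∈ spectrum ℂ b, ‖z‖ = specRad b := by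
  obtain ⟨z, hz, h⟩ := spectrum.exists_nnnorm_eq_spectralRadius b
  exact ⟨z, hz, by rw [specRad, ← h]; simp⟩

theorem mem_resolventSet_of_specRad_lt {b : B} {w : ℂ} (h : specRad b < ‖w‖) :
    w ∈ resolventSet ℂ b := by
  by_contra hw
  exact absurd (norm_le_specRad hw) (not_le.2 h)

theorem eventually_norm_pow_le {b : B} {t : ℝ} (h : specRad b < t) :
    ∀ᶠ n : ℕ in atTop, ‖b ^ n‖ ≤ t ^ n := by
  have ht : 0 < t := (specRad_nonneg b).trans_lt h
  have h' : spectralRadius ℂ b < ENNReal.ofReal t := by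
    rw [← ofReal_specRad]; exact (ENNReal.ofReal_lt_ofReal_iff ht).2 h
  filter_upwards [(spectrum.pow_norm_pow_one_div_tendsto_nhds_spectralRadius b).eventually_lt_const
    h', eventually_gt_atTop 0] with n hn hn0
  have h1 : ‖b ^ n‖ ^ (1 / n : ℝ) < t := (ENNReal.ofReal_lt_ofReal_iff ht).1 hn
  have h2 := pow_le_pow_left₀ (by positivity) h1.le n
  rwa [← Real.rpow_natCast, ← Real.rpow_mul (norm_nonneg _), one_div,
    inv_mul_cancel₀ (by positivity), Real.rpow_one] at h2

theorem tendsto_pow_zero_of_specRad_lt_one {b : B} (h : specRad b < 1) :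
    Tendsto (fun n : ℕ => b ^ n) atTop (𝓝 0) := by
  obtain ⟨t, ht, ht1⟩ := exists_between h
  refine squeeze_zero_norm' (eventually_norm_pow_le ht)
    (tendsto_pow_atTop_nhds_zero_of_lt_one ((specRad_nonneg b).trans ht.le) ht1)

/-- The Neumann series of the resolvent converges outside the spectral disc. -/
theorem hasSum_resolvent {b : B} {w : ℂ} (h : specRad b < ‖w‖) :
    HasSum (fun n : ℕ => (w⁻¹) ^ (n + 1) • b ^ n) (resolvent b w) := by
  have hw := mem_resolventSet_of_specRad_lt h
  obtain ⟨t, ht, ht1⟩ := exists_between h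
  have ht0 : 0 ≤ t := (specRad_nonneg b).trans ht.le
  have hw0 : 0 < ‖w‖ := ht0.trans_lt ht1
  have hw1 : w ≠ 0 := norm_pos_iff.1 hw0
  have hgeo : Summable fun n : ℕ => ‖w‖⁻¹ * (t / ‖w‖) ^ n :=
    (summable_geometric_of_lt_one (by positivity) ((div_lt_one hw0).2 ht1)).mul_left _
  have hsum : Summable (fun n : ℕ => (w⁻¹) ^ (n + 1) • b ^ n) := by
    refine Summable.of_norm_bounded_eventually_nat hgeo ?_
    filter_upwards [eventually_norm_pow_le ht] with n hn
    rw [norm_smul, norm_pow, norm_inv, pow_succ', div_pow, inv_pow, mul_assoc]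
    gcongr
    rw [div_eq_inv_mul]
    gcongr
  -- The remainder after `n` terms is `w` times the `n`-th term times the resolvent, so it vanishes
  -- in the limit.
  have hpart : ∀ n : ℕ, ∑ i ∈ Finset.range n, (w⁻¹) ^ (i + 1) • b ^ i =
      resolvent b w - w • ((w⁻¹) ^ (n + 1) • b ^ n * resolvent b w) := by
    intro n
    induction n with
    | zero => simp [smul_smul, hw1]
    | succ n ih =>
      rw [Finset.sum_range_succ, ih]
      have e : b ^ (n + 1) * resolvent b w = w • (b ^ n * resolvent b w) - b ^ n := by
        rw [pow_succ, mul_assoc, mul_resolvent hw, mul_sub, mul_one, mul_smul_comm]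
      rw [smul_mul_assoc, smul_mul_assoc, e, smul_sub, smul_smul, smul_smul, smul_sub, smul_smul,
        smul_smul]
      have e1 : w * ((w⁻¹) ^ (n + 1 + 1) * w) = w * w⁻¹ ^ (n + 1) := by
        rw [pow_succ w⁻¹ (n + 1), mul_assoc, inv_mul_cancel₀ hw1, mul_one]
      have e2 : w * (w⁻¹) ^ (n + 1 + 1) = w⁻¹ ^ (n + 1) := by
        rw [pow_succ', ← mul_assoc, mul_inv_cancel₀ hw1, one_mul]
      rw [e1, e2]; abel
  rw [hsum.hasSum_iff_tendsto_nat]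
  simp_rw [hpart]
  have := ((hsum.tendsto_atTop_zero.mul_const (resolvent b w)).const_smul w).const_sub
    (resolvent b w)
  simpa using this

/-- The sum of a power series in `w - z`, known only on a punctured disc, tends to its constant
coefficient. -/
theorem tendsto_of_hasSum_pow {z : ℂ} {ε : ℝ} (hε : 0 < ε) {e : ℕ → B} {F : ℂ → B}
    (h : ∀ w : ℂ, 0 < ‖w - z‖ → ‖w - z‖ < ε → HasSum (fun n : ℕ => (w - z) ^ n • e n) (F w)) :
    Tendsto F (𝓝[≠] z) (𝓝 (e 0)) := by
  -- Convergence at distance `ε / 2` bounds the coefficients; within `ε / 4` the series is then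
  -- dominated by a geometric one of ratio `1 / 2`.
  have hs : Summable fun n : ℕ => (((ε / 2 : ℝ) : ℂ)) ^ n • e n := by
    have := (h (z + (ε / 2 : ℝ)) (by simp [hε.ne']) (by
      simp only [add_sub_cancel_left, Complex.norm_real, Real.norm_eq_abs]
      rw [abs_of_pos (by positivity)]; linarith)).summable
    simpa using this
  obtain ⟨M, hM⟩ := hs.tendsto_atTop_zero.norm.bddAbove_range
  have hM' : ∀ n, (ε / 2) ^ n * ‖e n‖ ≤ M := fun n => by
    have := hM ⟨n, rfl⟩
    simpa [norm_smul, abs_of_pos hε] using this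
  have hne : ∀ᶠ w in 𝓝[≠] z, w ≠ z := eventually_mem_nhdsWithin
  have hlt : ∀ δ : ℝ, 0 < δ → ∀ᶠ w in 𝓝[≠] z, ‖w - z‖ < δ := fun δ hδ => by
    have : ∀ᶠ w in 𝓝 z, ‖w - z‖ < δ := by
      filter_upwards [Metric.ball_mem_nhds z hδ] with w hw
      rwa [Metric.mem_ball, dist_eq_norm] at hw
    exact this.filter_mono nhdsWithin_le_nhds
  have key : Tendsto (fun w => ∑' n : ℕ, (w - z) ^ n • e n) (𝓝[≠] z)
      (𝓝 (∑' n : ℕ, (0 : ℂ) ^ n • e n)) := by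
    refine tendsto_tsum_of_dominated_convergence (bound := fun n => M * (1 / 2 : ℝ) ^ n)
      (summable_geometric_two.mul_left M) (fun n => ?_) ?_
    · have : Tendsto (fun w : ℂ => w - z) (𝓝[≠] z) (𝓝 0) := by
        have : Tendsto (fun w : ℂ => w - z) (𝓝 z) (𝓝 (z - z)) := tendsto_id.sub_const z
        rw [sub_self] at this
        exact this.mono_left nhdsWithin_le_nhds
      exact (this.pow n).smul_const _
    · filter_upwards [hlt (ε / 4) (by positivity)] with w hw n
      rw [norm_smul, norm_pow]
      calc ‖w - z‖ ^ n * ‖e n‖ ≤ (ε / 4) ^ n * ‖e n‖ := by gcongr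
        _ = ((ε / 2) ^ n * ‖e n‖) * (1 / 2) ^ n := by
          rw [show ε / 4 = ε / 2 * (1 / 2) by ring, mul_pow]; ring
        _ ≤ M * (1 / 2) ^ n := by gcongr; exact hM' n
  have e0 : ∑' n : ℕ, (0 : ℂ) ^ n • e n = e 0 := by
    rw [tsum_eq_single 0 fun n hn => by simp [hn]]; simp
  rw [e0] at key
  refine key.congr' ?_
  filter_upwards [hne, hlt ε hε] with w hw hw'
  exact (h w (norm_pos_iff.2 (sub_ne_zero.2 hw)) hw').tsum_eq

theorem hasSum_laurent_nat {w z : ℂ} (hw : w ≠ z) {c : ℤ → B} {x : B} {k : ℕ}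
    (h : HasSum (fun j : ℤ => (w - z) ^ j • c j) x) (hk : ∀ j : ℤ, j < -(k : ℤ) → c j = 0) :
    HasSum (fun n : ℕ => (w - z) ^ n • c (n - k)) ((w - z) ^ k • x) := by
  have hinj : Function.Injective fun n : ℕ => ((n : ℤ) - k) := fun m n hmn => by
    simpa using hmn
  have h' := (hinj.hasSum_iff (f := fun j : ℤ => (w - z) ^ j • c j) (a := x) fun j hj => by
    have : j < -(k : ℤ) := by
      by_contra hlt
      exact hj ⟨(j + k).toNat, by simp only; omega⟩
    rw [hk j this, smul_zero]).2 h
  convert h'.const_smul ((w - z) ^ k) using 1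
  funext n
  rw [Function.comp_apply, smul_smul, ← zpow_natCast, ← zpow_natCast,
    ← zpow_add₀ (sub_ne_zero.2 hw), add_sub_cancel]

theorem IsLaurentExpansion.tendsto_leading {b : B} {z : ℂ} {c : ℤ → B}
    (h : IsLaurentExpansion b z c) {k : ℕ} (hk : ∀ j : ℤ, j < -(k : ℤ) → c j = 0) :
    Tendsto (fun w => (w - z) ^ k • resolvent b w) (𝓝[≠] z) (𝓝 (c (-(k : ℤ)))) := by
  obtain ⟨ε, hε, h⟩ := h
  have := tendsto_of_hasSum_pow hε (z := z) (e := fun n : ℕ => c (n - k))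
    (F := fun w => (w - z) ^ k • resolvent b w) fun w h0 h1 =>
      hasSum_laurent_nat (sub_ne_zero.1 (norm_pos_iff.1 h0)) (h w h0 h1).2 hk
  simpa using this

/-- At a simple pole, the resolvent minus its principal part tends to the constant coefficient. -/
theorem IsLaurentExpansion.tendsto_regular {b : B} {z : ℂ} {c : ℤ → B}
    (h : IsLaurentExpansion b z c) (hk : ∀ j : ℤ, j < -1 → c j = 0) :
    Tendsto (fun w => resolvent b w - (w - z)⁻¹ • c (-1)) (𝓝[≠] z) (𝓝 (c 0)) := by
  obtain ⟨ε, hε, h⟩ := h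
  refine tendsto_of_hasSum_pow hε (z := z) (e := fun n : ℕ => c n) fun w h0 h1 => ?_
  have hne := norm_pos_iff.1 h0
  have h2 := hasSum_laurent_nat (k := 1) (sub_ne_zero.1 hne) (h w h0 h1).2 (by simpa using hk)
  have h3 := (hasSum_nat_add_iff' 1).2 h2
  have h4 := h3.const_smul (w - z)⁻¹
  simp only [Finset.sum_range_one, pow_zero, one_smul, Nat.cast_zero, pow_one, smul_sub, smul_smul,
    inv_mul_cancel₀ hne, Nat.cast_one, zero_sub, Nat.cast_add, add_sub_cancel_right] at h4
  have e : (fun n : ℕ => ((w - z)⁻¹ * (w - z) ^ (n + 1)) • c n) =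
      fun n : ℕ => (w - z) ^ n • c n := by
    funext n
    rw [pow_succ', ← mul_assoc, inv_mul_cancel₀ hne, one_mul]
  rwa [e] at h4

end SpectralTheory

/-! ### Behaviour under scalar multiples and powers -/

section Scaling

variable {B : Type u} [NormedRing B] [NormedAlgebra ℂ B]

theorem mem_spectrum_smul_iff {b : B} {t z : ℂ} (ht : t ≠ 0) :
    t * z ∈ spectrum ℂ (t • b) ↔ z ∈ spectrum ℂ b := by
  have := spectrum.smul_mem_smul_iff (a := b) (s := z) (r := Units.mk0 t ht)
  simpa [Units.smul_def] using this

theorem resolvent_smul {b : B} {t z : ℂ} (ht : t ≠ 0) :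
    resolvent (t • b) (t * z) = t⁻¹ • resolvent b z := by
  have := spectrum.units_smul_resolvent (R := ℂ) (r := Units.mk0 t ht) (s := t * z) (a := t • b)
  simp only [Units.smul_def, Units.val_mk0, Units.val_inv_eq_inv_val, smul_eq_mul, smul_smul,
    inv_mul_cancel_left₀ ht, inv_mul_cancel₀ ht, one_smul] at this
  rw [← this, smul_smul, inv_mul_cancel₀ ht, one_smul]

theorem IsPole.smul {b : B} {z : ℂ} (h : IsPole b z) {t : ℂ} (ht : t ≠ 0) :
    IsPole (t • b) (t * z) := by
  obtain ⟨k, hk, hz, c, ⟨ε, hε, hc⟩, hc0, hck⟩ := h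
  -- The exponent `-j - 1` combines `R(tw, tb) = t⁻¹R(w, b)` with the factor `tʲ` in `(tw - tz)ʲ`.
  refine ⟨k, hk, (mem_spectrum_smul_iff ht).2 hz, fun j => t ^ (-j - 1) • c j,
    ⟨‖t‖ * ε, by positivity, fun w h0 h1 => ?_⟩, fun j hj => by simp only [hc0 j hj, smul_zero], ?_⟩
  · obtain ⟨v, rfl⟩ : ∃ v, w = t * v := ⟨t⁻¹ * w, by rw [mul_inv_cancel_left₀ ht]⟩
    have ht' : 0 < ‖t‖ := norm_pos_iff.2 ht
    rw [← mul_sub, norm_mul] at h0 h1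
    obtain ⟨h2, h3⟩ := hc v (pos_of_mul_pos_right h0 ht'.le) (lt_of_mul_lt_mul_left h1 ht'.le)
    refine ⟨by_contra fun h => (mem_spectrum_smul_iff ht).1 h h2, ?_⟩
    rw [resolvent_smul ht]
    convert h3.const_smul t⁻¹ using 1
    funext j
    rw [smul_smul, smul_smul, ← mul_sub, mul_zpow, zpow_sub₀ ht, zpow_neg, zpow_one]
    congr 1
    have := zpow_ne_zero j ht
    field_simp
  · exact smul_ne_zero (zpow_ne_zero _ ht) hck

theorem specRad_smul [CompleteSpace B] [Nontrivial B] (b : B) {t : ℂ} (ht : t ≠ 0) :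
    specRad (t • b) = ‖t‖ * specRad b := by
  apply le_antisymm
  · obtain ⟨z, hz, h⟩ := exists_norm_eq_specRad (t • b)
    obtain ⟨v, rfl⟩ : ∃ v, z = t * v := ⟨t⁻¹ * z, by rw [mul_inv_cancel_left₀ ht]⟩
    rw [← h, norm_mul]
    exact mul_le_mul_of_nonneg_left (norm_le_specRad ((mem_spectrum_smul_iff ht).1 hz))
      (norm_nonneg _)
  · obtain ⟨z, hz, h⟩ := exists_norm_eq_specRad b
    rw [← h, ← norm_mul]
    exact norm_le_specRad ((mem_spectrum_smul_iff ht).2 hz)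

theorem mem_peripheralSpectrum_smul_iff [CompleteSpace B] [Nontrivial B] {b : B} {t z : ℂ}
    (ht : t ≠ 0) : t * z ∈ peripheralSpectrum (t • b) ↔ z ∈ peripheralSpectrum b := by
  simp only [peripheralSpectrum, Set.mem_ofPred_eq, mem_spectrum_smul_iff ht, specRad_smul b ht,
    norm_mul, mul_right_inj' (norm_ne_zero_iff.2 ht)]

theorem specRad_pow [CompleteSpace B] [Nontrivial B] (b : B) (n : ℕ) :
    specRad (b ^ n) = specRad b ^ n := by
  apply le_antisymm
  · obtain ⟨z, hz, h⟩ := exists_norm_eq_specRad (b ^ n)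
    rw [spectrum.map_pow b n] at hz
    obtain ⟨v, hv, rfl⟩ := hz
    rw [← h, norm_pow]
    exact pow_le_pow_left₀ (norm_nonneg _) (norm_le_specRad hv) n
  · obtain ⟨z, hz, h⟩ := exists_norm_eq_specRad b
    rw [← h, ← norm_pow]
    exact norm_le_specRad (spectrum.pow_mem_pow b n hz)

end Scaling

/-! ### Convergence of powers and the peripheral spectrum -/

section PowerConvergence

variable {B : Type u} [NormedRing B] [NormedAlgebra ℂ B] [CompleteSpace B]

/-- If the powers of `b` converge then `1` is the only possible unimodular spectral value. -/
theorem eq_one_of_tendsto_pow {b L : B} (h : Tendsto (fun n : ℕ => b ^ n) atTop (𝓝 L)) {z : ℂ}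
    (hz : z ∈ spectrum ℂ b) (hz1 : ‖z‖ = 1) : z = 1 := by
  by_contra hne
  have hz0 : z ≠ 0 := norm_ne_zero_iff.1 (by rw [hz1]; exact one_ne_zero)
  have hshift := (tendsto_add_atTop_iff_nat 1).2 h
  have hbL : b * L = L := tendsto_nhds_unique (by simpa [← pow_succ'] using h.const_mul b) hshift
  have hLb : L * b = L := tendsto_nhds_unique (by simpa [← pow_succ] using h.mul_const b) hshift
  have hpL : ∀ n : ℕ, b ^ n * L = L := fun n => by
    induction n with
    | zero => simp
    | succ n ih => rw [pow_succ, mul_assoc, hbL, ih]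
  have hLL : L * L = L := tendsto_nhds_unique (h.mul_const L) (by simp [hpL])
  -- Subtracting the idempotent `L` removes the part where `b` acts as the identity. The shift is
  -- needed because the formula can fail at exponent `0`.
  have hE : ∀ n : ℕ, (b - L) ^ (n + 1) = b ^ (n + 1) - L := fun n => by
    induction n with
    | zero => simp
    | succ n ih =>
      rw [pow_succ, ih, mul_sub, sub_mul, sub_mul, ← pow_succ, hLb, hpL, hLL]; abel
  have hlim : Tendsto (fun n : ℕ => ((z⁻¹) ^ (n + 1)) • (b - L) ^ (n + 1)) atTop (𝓝 0) := by
    rw [tendsto_zero_iff_norm_tendsto_zero]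
    have : Tendsto (fun n : ℕ => ‖b ^ (n + 1) - L‖) atTop (𝓝 0) := by
      simpa using (hshift.sub_const L).norm
    refine this.congr fun n => ?_
    rw [norm_smul, norm_pow, norm_inv, hz1, hE]; simp
  obtain ⟨n, hn⟩ := (hlim.norm.eventually_lt_const (u := 1) (by simp)).exists
  -- Otherwise `zⁿ⁺¹` would be spectral for `(b - L)ⁿ⁺¹`, whose norm is below `1 = |z|ⁿ⁺¹` for the
  -- chosen `n`.
  have hu : z ∈ resolventSet ℂ (b - L) := by
    by_contra hzE
    have h1 := spectrum.pow_mem_pow (b - L) (n + 1) hzE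
    apply h1
    have h2 : IsUnit (1 - (z⁻¹) ^ (n + 1) • (b - L) ^ (n + 1)) := isUnit_one_sub_of_norm_lt_one hn
    have h3 : algebraMap ℂ B (z ^ (n + 1)) - (b - L) ^ (n + 1) =
        algebraMap ℂ B (z ^ (n + 1)) * (1 - (z⁻¹) ^ (n + 1) • (b - L) ^ (n + 1)) := by
      rw [mul_sub, mul_one, ← Algebra.smul_def, smul_smul, ← mul_pow, mul_inv_cancel₀ hz0, one_pow,
        one_smul]
    rw [spectrum.mem_resolventSet_iff, h3]
    exact ((IsUnit.mk0 _ (pow_ne_zero _ hz0)).map (algebraMap ℂ B)).mul h2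
  set V := resolvent (b - L) z
  have hEL : (b - L) * L = (0 : ℂ) • L := by rw [sub_mul, hbL, hLL]; simp
  have hLE : L * (b - L) = (0 : ℂ) • L := by rw [mul_sub, hLb, hLL]; simp
  have hVL : V * L = z⁻¹ • L := by
    simpa using resolvent_mul_of_mul_eq_smul hu hz0 hEL
  have hLV : L * V = z⁻¹ • L := by
    simpa using mul_resolvent_of_mul_eq_smul hu hz0 hLE
  have hEV : (b - L) * V = z • V - 1 := mul_resolvent hu
  have hVE : V * (b - L) = z • V - 1 := resolvent_mul hu
  have hbV : b * V = z • V - 1 + z⁻¹ • L := by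
    rw [← hEV, ← hLV]; noncomm_ring
  have hVb : V * b = z • V - 1 + z⁻¹ • L := by
    rw [← hVE, ← hVL]; noncomm_ring
  have hz1' : z - 1 ≠ 0 := sub_ne_zero.2 hne
  apply hz
  rw [spectrum.mem_resolventSet_iff, isUnit_iff_exists]
  -- On the range of `L`, where `b - L` is `0` but `b` is `1`, the factor `z⁻¹` is replaced by `(z -
  -- 1)⁻¹`.
  refine ⟨V - z⁻¹ • L + (z - 1)⁻¹ • L, ?_, ?_⟩
  · rw [sub_mul, ← Algebra.smul_def]
    simp only [mul_add, mul_sub, mul_smul_comm, hbV, hbL]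
    match_scalars <;> field_simp <;> ring
  · rw [mul_sub, ← Algebra.commutes, ← Algebra.smul_def]
    simp only [add_mul, sub_mul, smul_mul_assoc, hVb, hLb]
    match_scalars <;> field_simp <;> ring

/-- A simple pole at `1`, the only peripheral spectral value, forces the powers to converge. -/
theorem tendsto_pow_of_simple_pole [Nontrivial B] {b : B} {c : ℤ → B} (hr : specRad b = 1)
    (hc : IsLaurentExpansion b 1 c) (hk : ∀ j : ℤ, j < -1 → c j = 0)
    (hbc : b * c (-1) = c (-1)) (hcb : c (-1) * b = c (-1)) (hcc : c (-1) * c (-1) = c (-1))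
    (hper : ∀ z ∈ peripheralSpectrum b, z = 1) :
    Tendsto (fun n : ℕ => b ^ n) atTop (𝓝 (c (-1))) := by
  set e := c (-1) with he
  have hlim := hc.tendsto_regular hk
  have hE : ∀ n : ℕ, (b - e) ^ (n + 1) = b ^ (n + 1) - e := fun n => by
    have hpL : ∀ n : ℕ, b ^ n * e = e := fun n => by
      induction n with
      | zero => simp
      | succ n ih => rw [pow_succ, mul_assoc, hbc, ih]
    induction n with
    | zero => simp
    | succ n ih =>
      rw [pow_succ, ih, mul_sub, sub_mul, sub_mul, ← pow_succ, hcb, hpL, hcc]; abel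
  -- Passing from `b` to `b - e` changes the eigenvalue on the range of `e` from `1` to `0`, so `(w
  -- - 1)⁻¹` is traded for `w⁻¹`.
  have hreg : ∀ w : ℂ, w ∈ resolventSet ℂ b → w ≠ 1 → w ≠ 0 →
      (algebraMap ℂ B w - (b - e)) * (resolvent b w - (w - 1)⁻¹ • e + w⁻¹ • e) = 1 ∧
      (resolvent b w - (w - 1)⁻¹ • e + w⁻¹ • e) * (algebraMap ℂ B w - (b - e)) = 1 := by
    intro w hw hw1 hw0
    have hw1' : w - 1 ≠ 0 := sub_ne_zero.2 hw1
    have hRe : resolvent b w * e = (w - 1)⁻¹ • e :=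
      resolvent_mul_of_mul_eq_smul hw hw1 (by rw [one_smul, hbc])
    have heR : e * resolvent b w = (w - 1)⁻¹ • e :=
      mul_resolvent_of_mul_eq_smul hw hw1 (by rw [one_smul, hcb])
    constructor
    · rw [sub_mul, ← Algebra.smul_def]
      simp only [sub_mul, mul_add, mul_sub, mul_smul_comm, hbc, hcc, heR, mul_resolvent hw]
      match_scalars <;> field_simp <;> ring
    · rw [mul_sub, ← Algebra.commutes, ← Algebra.smul_def]
      simp only [mul_sub, add_mul, sub_mul, smul_mul_assoc, hcb, hcc, hRe, resolvent_mul hw]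
      match_scalars <;> field_simp <;> ring
  have hres : ∀ w : ℂ, 1 ≤ ‖w‖ → w ∈ resolventSet ℂ (b - e) := by
    intro w hw
    have hw0 : w ≠ 0 := norm_pos_iff.1 (one_pos.trans_le hw)
    rw [spectrum.mem_resolventSet_iff, isUnit_iff_exists]
    by_cases hw1 : w = 1
    · subst hw1
      have hev : ∀ᶠ w : ℂ in 𝓝[≠] 1, w ∈ resolventSet ℂ b ∧ w ≠ 1 ∧ w ≠ 0 := by
        obtain ⟨ε, hε, h⟩ := hc
        filter_upwards [eventually_mem_nhdsWithin,
          nhdsWithin_le_nhds (Metric.ball_mem_nhds (1 : ℂ) hε),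
          nhdsWithin_le_nhds (isOpen_ne.mem_nhds (one_ne_zero (α := ℂ)))] with w h1 h2 h3
        rw [Metric.mem_ball, dist_eq_norm] at h2
        exact ⟨(h w (norm_pos_iff.2 (sub_ne_zero.2 h1)) h2).1, h1, h3⟩
      have hid : Tendsto (fun w : ℂ => w) (𝓝[≠] (1 : ℂ)) (𝓝 1) := nhdsWithin_le_nhds
      have hl1 : Tendsto (fun w : ℂ => resolvent b w - (w - 1)⁻¹ • e + w⁻¹ • e) (𝓝[≠] 1)
          (𝓝 (c 0 + (1 : ℂ)⁻¹ • e)) := hlim.add ((hid.inv₀ one_ne_zero).smul_const e)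
      have hl2 : Tendsto (fun w : ℂ => algebraMap ℂ B w - (b - e)) (𝓝[≠] 1)
          (𝓝 (algebraMap ℂ B 1 - (b - e))) :=
        (((continuous_algebraMap ℂ B).tendsto 1).comp hid).sub_const _
      -- At `w = 1` the inverse formula is singular term by term, but the singular parts cancel and
      -- its limit is still an inverse.
      refine ⟨c 0 + (1 : ℂ)⁻¹ • e, tendsto_nhds_unique (hl2.mul hl1) ?_,
        tendsto_nhds_unique (hl1.mul hl2) ?_⟩
      · refine tendsto_const_nhds.congr' ?_
        filter_upwards [hev] with w hw
        exact (hreg w hw.1 hw.2.1 hw.2.2).1.symm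
      · refine tendsto_const_nhds.congr' ?_
        filter_upwards [hev] with w hw
        exact (hreg w hw.1 hw.2.1 hw.2.2).2.symm
    · have hwb : w ∈ resolventSet ℂ b := by
        by_contra hwb
        have : ‖w‖ = specRad b := le_antisymm (norm_le_specRad hwb) (hr ▸ hw)
        exact hw1 (hper w ⟨hwb, this⟩)
      exact ⟨_, hreg w hwb hw1 hw0⟩
  have hlt : specRad (b - e) < 1 := by
    obtain ⟨z, hz, h⟩ := exists_norm_eq_specRad (b - e)
    rw [← h]
    by_contra hge
    exact hz (hres z (not_lt.1 hge))
  have h0 := (tendsto_add_atTop_iff_nat 1).2 (tendsto_pow_zero_of_specRad_lt_one hlt)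
  rw [← tendsto_add_atTop_iff_nat 1]
  simp only [hE] at h0
  simpa using h0.add_const e

end PowerConvergence

/-! ### Abel means along rays -/

section AbelMeans

theorem hasSum_congr {E : Type*} [AddCommMonoid E] [TopologicalSpace E] {f g : ℕ → E} {S : E}
    (h : ∀ n, f n = g n) : HasSum f S ↔ HasSum g S := by
  rw [funext h]

variable {B : Type u} [NormedRing B] [NormedAlgebra ℂ B]

/-- The Abel mean `(t - 1) ∑ₙ t⁻ⁿ⁻¹ ω⁻ⁿ bⁿ` of `ω⁻¹b`, written through the resolvent. -/
noncomputable def abelMean (b : B) (ω : ℂ) (t : ℝ) : B :=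
  (ω * (t - 1 : ℝ)) • resolvent b (ω * t)

variable [CompleteSpace B]

theorem specRad_lt_norm_mul {b : B} (hr : specRad b = 1) {ω : ℂ} (hω : ‖ω‖ = 1) {t : ℝ}
    (ht : 1 < t) : specRad b < ‖ω * (t : ℂ)‖ := by
  rw [hr, norm_mul, hω, one_mul, Complex.norm_real, Real.norm_eq_abs]
  exact ht.trans_le (le_abs_self t)

theorem hasSum_abelMean {b : B} (hr : specRad b = 1) {ω : ℂ} (hω : ‖ω‖ = 1) {t : ℝ}
    (ht : 1 < t) :
    HasSum (fun n : ℕ => ((t - 1) * (t⁻¹) ^ (n + 1) : ℝ) • ((ω⁻¹) ^ n • b ^ n))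
      (abelMean b ω t) := by
  have hω0 : ω ≠ 0 := norm_ne_zero_iff.1 (by rw [hω]; exact one_ne_zero)
  refine (hasSum_congr fun n => ?_).2
    ((hasSum_resolvent (specRad_lt_norm_mul hr hω ht)).const_smul (ω * (t - 1 : ℝ)))
  rw [← Complex.coe_smul, smul_smul, smul_smul]
  congr 1
  push_cast
  rw [mul_inv, mul_pow, pow_succ ω⁻¹ n]
  field_simp

/-- In the limit this shows that a residue obtained from Abel means is idempotent. -/
theorem abelMean_mul {b : B} (hr : specRad b = 1) {ω : ℂ} (hω : ‖ω‖ = 1) {t : ℝ}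
    (ht : 1 < t) {z : B} (h : b * z = ω • z) : abelMean b ω t * z = z := by
  have hω0 : ω ≠ 0 := norm_ne_zero_iff.1 (by rw [hω]; exact one_ne_zero)
  have ht' : ((t - 1 : ℝ) : ℂ) ≠ 0 := by exact_mod_cast (sub_pos.2 ht).ne'
  have e : ω * (t : ℂ) - ω = ω * (t - 1 : ℝ) := by push_cast; ring
  have hne : ω * (t : ℂ) ≠ ω := by rw [← sub_ne_zero, e]; exact mul_ne_zero hω0 ht'
  rw [abelMean, smul_mul_assoc, resolvent_mul_of_mul_eq_smul
    (mem_resolventSet_of_specRad_lt (specRad_lt_norm_mul hr hω ht)) hne h, smul_smul, e,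
    mul_inv_cancel₀ (mul_ne_zero hω0 ht'), one_smul]

theorem mul_abelMean {b : B} (hr : specRad b = 1) {ω : ℂ} (hω : ‖ω‖ = 1) {t : ℝ}
    (ht : 1 < t) {z : B} (h : z * b = ω • z) : z * abelMean b ω t = z := by
  have hω0 : ω ≠ 0 := norm_ne_zero_iff.1 (by rw [hω]; exact one_ne_zero)
  have ht' : ((t - 1 : ℝ) : ℂ) ≠ 0 := by exact_mod_cast (sub_pos.2 ht).ne'
  have e : ω * (t : ℂ) - ω = ω * (t - 1 : ℝ) := by push_cast; ring
  have hne : ω * (t : ℂ) ≠ ω := by rw [← sub_ne_zero, e]; exact mul_ne_zero hω0 ht'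
  rw [abelMean, mul_smul_comm, mul_resolvent_of_mul_eq_smul
    (mem_resolventSet_of_specRad_lt (specRad_lt_norm_mul hr hω ht)) hne h, smul_smul, e,
    mul_inv_cancel₀ (mul_ne_zero hω0 ht'), one_smul]

theorem tendsto_sub_one_zero : Tendsto (fun t : ℝ => t - 1) (𝓝[>] 1) (𝓝 0) := by
  have : Tendsto (fun t : ℝ => t - 1) (𝓝 1) (𝓝 (1 - 1)) := tendsto_id.sub_const 1
  rw [sub_self] at this
  exact this.mono_left nhdsWithin_le_nhds

/-- Limits of (scaled) Abel means are eigenvectors. -/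
theorem eigenvector_of_tendsto_abelMean {b : B} (hr : specRad b = 1) {ω : ℂ} (hω : ‖ω‖ = 1)
    {m : ℕ} {d : B} (h : Tendsto (fun t : ℝ => (t - 1) ^ m • abelMean b ω t) (𝓝[>] 1) (𝓝 d)) :
    b * d = ω • d ∧ d * b = ω • d := by
  have hs := tendsto_sub_one_zero
  have ht1 : Tendsto (fun t : ℝ => t) (𝓝[>] (1 : ℝ)) (𝓝 1) := nhdsWithin_le_nhds
  -- By `bR = ωtR - 1`, multiplying a scaled mean by `b` gives `tω` times it minus a multiple of `1`
  -- that vanishes as `t ↓ 1`.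
  have hlim : Tendsto (fun t : ℝ => t • ω • ((t - 1) ^ m • abelMean b ω t)
      - ((t - 1) ^ m * (t - 1)) • (ω • (1 : B))) (𝓝[>] 1) (𝓝 (ω • d)) := by
    have h2 : Tendsto (fun t : ℝ => (t - 1) ^ m * (t - 1)) (𝓝[>] 1) (𝓝 0) := by
      simpa using (hs.pow m).mul hs
    simpa using (ht1.smul (h.const_smul ω)).sub (h2.smul_const (ω • (1 : B)))
  have key : ∀ t : ℝ, t • ω • ((t - 1) ^ m • abelMean b ω t)
      - ((t - 1) ^ m * (t - 1)) • (ω • (1 : B)) = ((t - 1) ^ m : ℝ) • ((ω * (t - 1 : ℝ)) •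
        ((ω * (t : ℂ)) • resolvent b (ω * t) - 1)) := by
    intro t
    simp only [abelMean, ← Complex.coe_smul, smul_sub, smul_smul]
    congr 2 <;> push_cast <;> ring
  constructor
  · refine tendsto_nhds_unique (h.const_mul b) (hlim.congr' ?_)
    filter_upwards [eventually_mem_nhdsWithin] with t ht
    rw [key, ← mul_resolvent (mem_resolventSet_of_specRad_lt (specRad_lt_norm_mul hr hω ht)),
      mul_smul_comm, abelMean, mul_smul_comm]
  · refine tendsto_nhds_unique (h.mul_const b) (hlim.congr' ?_)
    filter_upwards [eventually_mem_nhdsWithin] with t ht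
    rw [key, ← resolvent_mul (mem_resolventSet_of_specRad_lt (specRad_lt_norm_mul hr hω ht)),
      smul_mul_assoc, abelMean, smul_mul_assoc]

theorem tendsto_ray {ω : ℂ} (hω : ω ≠ 0) :
    Tendsto (fun t : ℝ => ω * (t : ℂ)) (𝓝[>] 1) (𝓝[≠] ω) := by
  refine tendsto_nhdsWithin_iff.2 ⟨?_, ?_⟩
  · have : Continuous fun t : ℝ => ω * (t : ℂ) := by fun_prop
    have h := this.tendsto 1
    simp only [Complex.ofReal_one, mul_one] at h
    exact h.mono_left nhdsWithin_le_nhds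
  · filter_upwards [eventually_mem_nhdsWithin] with t ht
    intro h
    have : (t : ℂ) = 1 := by simpa [hω] using h
    exact (ne_of_gt ht : t ≠ 1) (by exact_mod_cast this)

/-- On the ray `w = ωt` one has `w - ω = ω(t - 1)`. The Abel mean already contains one such factor,
so a pole of order `k + 1` needs only `(t - 1)ᵏ` more. -/
theorem IsLaurentExpansion.tendsto_abelMean {b : B} {ω : ℂ} (hω : ω ≠ 0) {c : ℤ → B}
    (h : IsLaurentExpansion b ω c) {k : ℕ} (hk : ∀ j : ℤ, j < -((k + 1 : ℕ) : ℤ) → c j = 0) :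
    Tendsto (fun t : ℝ => (t - 1) ^ k • abelMean b ω t) (𝓝[>] 1)
      (𝓝 ((ω⁻¹) ^ k • c (-((k + 1 : ℕ) : ℤ)))) := by
  refine (((h.tendsto_leading hk).comp (tendsto_ray hω)).const_smul ((ω⁻¹) ^ k)).congr fun t => ?_
  simp only [Function.comp_apply, abelMean, ← Complex.coe_smul, smul_smul]
  congr 1
  have : ω * (t : ℂ) - ω = ω * (t - 1 : ℝ) := by push_cast; ring
  rw [this, mul_pow, pow_succ ω k, mul_assoc, ← mul_assoc, ← mul_assoc, ← mul_pow,
    inv_mul_cancel₀ hω]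
  push_cast
  ring

theorem tendsto_abelMean_of_mem_resolventSet {b : B} {ω : ℂ} (hω : ω ≠ 0)
    (h : ω ∈ resolventSet ℂ b) : Tendsto (fun t : ℝ => abelMean b ω t) (𝓝[>] 1) (𝓝 0) := by
  have h1 : Tendsto (fun t : ℝ => resolvent b (ω * t)) (𝓝[>] 1) (𝓝 (resolvent b ω)) :=
    (spectrum.hasDerivAt_resolvent_const_left h).continuousAt.tendsto.comp
      ((tendsto_ray hω).mono_right nhdsWithin_le_nhds)
  have h2 : Tendsto (fun t : ℝ => ω * ((t - 1 : ℝ) : ℂ)) (𝓝[>] 1) (𝓝 0) := by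
    have := ((Complex.continuous_ofReal.tendsto 0).comp tendsto_sub_one_zero).const_mul ω
    simpa using this
  simpa [abelMean] using h2.smul h1

end AbelMeans

/-! ### Positivity and domination of Abel means -/

section Positivity

variable {A : Type u} [NormedRing A] [NormedAlgebra ℂ A] [CompleteSpace A]
  [PartialOrder A] [IsOrderedRing A] [IsOrderedModule ℝ A] [OrderClosedTopology A]

theorem nonneg_of_hasSum {b S : A} (hb : 0 ≤ b) {s : ℕ → ℝ} (hs : ∀ n, 0 ≤ s n)
    (h : HasSum (fun n => s n • b ^ n) S) : 0 ≤ S :=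
  h.nonneg fun n => smul_nonneg (hs n) (pow_nonneg hb n)

/-- The constant term is subtracted because only positive powers of `b` are known to be order
continuous. -/
theorem orderContinuous_of_hasSum (h1 : AxiomA1 A) {b S : A} (hb : OrderContinuous b) {s : ℕ → ℝ}
    (hs : ∀ n, 0 ≤ s n) (h : HasSum (fun n => s n • b ^ n) S) :
    OrderContinuous (S - s 0 • 1) := by
  have h' := (hasSum_nat_add_iff' 1).2 h
  rw [Finset.sum_range_one, pow_zero] at h'
  refine h1.closed.mem_of_tendsto h'.tendsto_sum_nat (Eventually.of_forall fun n => ?_)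
  exact OrderContinuous.sum _ _ fun i _ => (hb.pow h1 i.succ_ne_zero).smul (hs _)

theorem hasSum_abelMean_one {b : A} (hr : specRad b = 1) {t : ℝ} (ht : 1 < t) :
    HasSum (fun n : ℕ => ((t - 1) * (t⁻¹) ^ (n + 1) : ℝ) • b ^ n) (abelMean b 1 t) := by
  simpa using hasSum_abelMean (ω := 1) hr (by simp) ht

/-- The Abel means of `ω⁻¹b` are dominated by those of `b`. -/
theorem exists_re_im_abelMean {b : A} (hb : 0 ≤ b) (hr : specRad b = 1) {ω : ℂ} (hω : ‖ω‖ = 1)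
    {t : ℝ} (ht : 1 < t) : ∃ X Y : A, abelMean b ω t = X + Complex.I • Y ∧
      -abelMean b 1 t ≤ X ∧ X ≤ abelMean b 1 t ∧ -abelMean b 1 t ≤ Y ∧ Y ≤ abelMean b 1 t := by
  have hω' : ‖(starRingEnd ℂ) ω‖ = 1 := by rw [RCLike.norm_conj, hω]
  have hM := hasSum_abelMean_one hr ht
  have hr0 : ∀ n : ℕ, 0 ≤ (t - 1) * (t⁻¹) ^ (n + 1) := fun n =>
    mul_nonneg (sub_pos.2 ht).le (pow_nonneg (inv_nonneg.2 (by linarith)) _)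
  have h1 := hasSum_abelMean hr hω ht
  have h2 := hasSum_abelMean hr hω' ht
  -- Combining the means at `ω` and at its conjugate replaces `ω⁻ⁿ` by its real or imaginary part;
  -- these have modulus at most `1`, whence the domination.
  have hX : HasSum (fun n : ℕ => ((t - 1) * (t⁻¹) ^ (n + 1) * ((ω⁻¹) ^ n).re : ℝ) • b ^ n)
      ((2⁻¹ : ℂ) • (abelMean b ω t + abelMean b ((starRingEnd ℂ) ω) t)) := by
    refine (hasSum_congr fun n => ?_).2 ((h1.add h2).const_smul (2⁻¹ : ℂ))
    simp only [← Complex.coe_smul, smul_smul, ← add_smul]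
    congr 1
    rw [← map_inv₀, ← map_pow, ← mul_add, Complex.add_conj]
    push_cast; ring
  have hY : HasSum (fun n : ℕ => ((t - 1) * (t⁻¹) ^ (n + 1) * ((ω⁻¹) ^ n).im : ℝ) • b ^ n)
      ((-Complex.I * 2⁻¹ : ℂ) • (abelMean b ω t - abelMean b ((starRingEnd ℂ) ω) t)) := by
    refine (hasSum_congr fun n => ?_).2 ((h1.sub h2).const_smul (-Complex.I * 2⁻¹ : ℂ))
    simp only [← Complex.coe_smul, smul_smul, ← sub_smul]
    congr 1
    rw [← map_inv₀, ← map_pow, ← mul_sub, Complex.sub_conj]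
    push_cast
    linear_combination ((t - 1 : ℂ) * (t : ℂ)⁻¹ ^ (n + 1) * ((ω⁻¹) ^ n).im) * Complex.I_mul_I
  have dom : ∀ (u : ℕ → ℝ) (Z : A), (∀ n, |u n| ≤ 1) →
      HasSum (fun n : ℕ => ((t - 1) * (t⁻¹) ^ (n + 1) * u n : ℝ) • b ^ n) Z →
      -abelMean b 1 t ≤ Z ∧ Z ≤ abelMean b 1 t := by
    intro u Z hu hZ
    constructor
    · rw [neg_le_iff_add_nonneg]
      refine nonneg_of_hasSum hb (s := fun n => (t - 1) * (t⁻¹) ^ (n + 1) * (u n + 1))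
        (fun n => mul_nonneg (hr0 n) (by linarith [(abs_le.1 (hu n)).1])) ?_
      refine (hasSum_congr fun n => ?_).2 (hZ.add hM)
      rw [← add_smul]; ring_nf
    · rw [← sub_nonneg]
      refine nonneg_of_hasSum hb (s := fun n => (t - 1) * (t⁻¹) ^ (n + 1) * (1 - u n))
        (fun n => mul_nonneg (hr0 n) (by linarith [(abs_le.1 (hu n)).2])) ?_
      refine (hasSum_congr fun n => ?_).2 (hM.sub hZ)
      rw [← sub_smul]; ring_nf
  have hn : ∀ n : ℕ, ‖(ω⁻¹) ^ n‖ = 1 := fun n => by rw [norm_pow, norm_inv, hω]; simp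
  obtain ⟨hX1, hX2⟩ := dom _ _ (fun n => (Complex.abs_re_le_norm _).trans_eq (hn n)) hX
  obtain ⟨hY1, hY2⟩ := dom _ _ (fun n => (Complex.abs_im_le_norm _).trans_eq (hn n)) hY
  refine ⟨_, _, ?_, hX1, hX2, hY1, hY2⟩
  have hI : Complex.I * (-Complex.I * 2⁻¹) = 2⁻¹ := by
    rw [← mul_assoc, mul_neg, Complex.I_mul_I]; norm_num
  rw [smul_smul, hI]
  module

theorem mem_regularElements_of_le {x M : A} (hM : 0 ≤ M) (h : -M ≤ x) : x ∈ regularElements A :=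
  ⟨x + M, M, neg_le_iff_add_nonneg.1 h, hM, by simp⟩

/-- (A₅) makes the real and imaginary parts converge separately, so their bounds survive in the
limit. As (A₅) concerns sequences, `t` runs through `1 + 1/(n + 1)`. -/
theorem exists_re_im_of_tendsto (h5 : AxiomA5 A) {b : A} (hb : 0 ≤ b) (hr : specRad b = 1) {ω : ℂ}
    (hω : ‖ω‖ = 1) {m : ℕ} {d e : A}
    (hd : Tendsto (fun t : ℝ => (t - 1) ^ m • abelMean b ω t) (𝓝[>] 1) (𝓝 d))
    (he : Tendsto (fun t : ℝ => (t - 1) ^ m • abelMean b 1 t) (𝓝[>] 1) (𝓝 e)) :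
    ∃ x y : A, d = x + Complex.I • y ∧ -e ≤ x ∧ x ≤ e ∧ -e ≤ y ∧ y ≤ e := by
  have hτ : Tendsto (fun n : ℕ => 1 + 1 / ((n : ℝ) + 1)) atTop (𝓝[>] 1) := by
    refine tendsto_nhdsWithin_iff.2 ⟨?_, Eventually.of_forall fun n => ?_⟩
    · simpa using (tendsto_one_div_add_atTop_nhds_zero_nat (𝕜 := ℝ)).const_add 1
    · have : 0 < 1 / ((n : ℝ) + 1) := by positivity
      simpa using this
  set τ : ℕ → ℝ := fun n => 1 + 1 / ((n : ℝ) + 1) with hτdef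
  have hτ1 : ∀ n, 1 < τ n := fun n => by
    have : 0 < 1 / ((n : ℝ) + 1) := by positivity
    simp only [hτdef]; linarith
  choose X Y hXY hX1 hX2 hY1 hY2 using fun n => exists_re_im_abelMean hb hr hω (hτ1 n)
  have hd' := hd.comp hτ
  have he' := he.comp hτ
  have hs0 : ∀ n, 0 ≤ (τ n - 1) ^ m := fun n => pow_nonneg (by linarith [hτ1 n]) m
  have hM0 : ∀ n, 0 ≤ (τ n - 1) ^ m • abelMean b 1 (τ n) := fun n => by
    refine smul_nonneg (hs0 n) (nonneg_of_hasSum hb (fun k => ?_) (hasSum_abelMean_one hr (hτ1 n)))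
    have := hτ1 n
    exact mul_nonneg (by linarith) (pow_nonneg (inv_nonneg.2 (by linarith)) _)
  have lo : ∀ Z : ℕ → A, (∀ n, -abelMean b 1 (τ n) ≤ Z n) →
      ∀ n, -((τ n - 1) ^ m • abelMean b 1 (τ n)) ≤ (τ n - 1) ^ m • Z n := fun Z h n => by
    rw [← smul_neg]; exact smul_le_smul_of_nonneg_left (h n) (hs0 n)
  have hi : ∀ Z : ℕ → A, (∀ n, Z n ≤ abelMean b 1 (τ n)) →
      ∀ n, (τ n - 1) ^ m • Z n ≤ (τ n - 1) ^ m • abelMean b 1 (τ n) := fun Z h n =>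
    smul_le_smul_of_nonneg_left (h n) (hs0 n)
  have hconv : Tendsto (fun n => (τ n - 1) ^ m • X n + Complex.I • ((τ n - 1) ^ m • Y n)) atTop
      (𝓝 d) := by
    refine hd'.congr fun n => ?_
    simp only [Function.comp_apply, hXY, smul_add]
    rw [smul_comm]
  obtain ⟨⟨x, hx⟩, y, hy⟩ := h5 _ _ (fun n => mem_regularElements_of_le (hM0 n) (lo X hX1 n))
    (fun n => mem_regularElements_of_le (hM0 n) (lo Y hY1 n)) ⟨d, hconv⟩
  refine ⟨x, y, tendsto_nhds_unique hconv (hx.add (hy.const_smul _)),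
    le_of_tendsto_of_tendsto' he'.neg hx (lo X hX1), le_of_tendsto_of_tendsto' hx he' (hi X hX2),
    le_of_tendsto_of_tendsto' he'.neg hy (lo Y hY1), le_of_tendsto_of_tendsto' hy he' (hi Y hY2)⟩

end Positivity

/-! ### Positive spectral radius and the residue at the spectral radius -/

section LeadingCoefficient

variable {A : Type u} [NormedRing A] [NormedAlgebra ℂ A] [CompleteSpace A] [Nontrivial A]
  [PartialOrder A] [IsOrderedRing A] [IsOrderedModule ℝ A] [OrderClosedTopology A]

/-- A positive quasinilpotent element with a pole of the resolvent at `0` is nilpotent. -/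
theorem exists_pow_eq_zero_of_isPole_zero {a : A} (ha : 0 ≤ a) (hr : specRad a = 0)
    (hp : IsPole a 0) : ∃ k : ℕ, a ^ k = 0 := by
  obtain ⟨k, -, -, c, hc, hc0, -⟩ := hp
  refine ⟨k, le_antisymm ?_ (pow_nonneg ha k)⟩
  have hray : Tendsto (fun t : ℝ => (t : ℂ)) (𝓝[>] 0) (𝓝[≠] 0) := by
    refine tendsto_nhdsWithin_iff.2 ⟨?_, ?_⟩
    · have := Complex.continuous_ofReal.tendsto 0
      rw [Complex.ofReal_zero] at this
      exact this.mono_left nhdsWithin_le_nhds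
    · filter_upwards [eventually_mem_nhdsWithin] with t ht
      exact Complex.ofReal_ne_zero.2 (ne_of_gt ht)
  have hid : Tendsto (fun t : ℝ => t) (𝓝[>] (0 : ℝ)) (𝓝 0) := nhdsWithin_le_nhds
  -- Here `tᵏR(t)` converges, so `tᵏ⁺¹R(t) → 0`; it dominates `aᵏ`, the `k`-th Neumann term
  -- multiplied by `tᵏ⁺¹`.
  have hlim := hid.smul ((hc.tendsto_leading hc0).comp hray)
  rw [zero_smul] at hlim
  refine ge_of_tendsto hlim ?_
  filter_upwards [eventually_mem_nhdsWithin] with t ht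
  have ht0 : 0 < t := ht
  have hs : HasSum (fun n : ℕ => (t⁻¹ ^ (n + 1)) • a ^ n) (resolvent a (t : ℂ)) := by
    refine (hasSum_congr fun n => ?_).2 (hasSum_resolvent (b := a) (w := (t : ℂ)) (by
      rw [hr, Complex.norm_real]; exact norm_pos_iff.2 ht0.ne'))
    rw [← Complex.coe_smul]; push_cast; rfl
  have hle := le_hasSum hs k fun n _ =>
    smul_nonneg (pow_nonneg (inv_nonneg.2 ht0.le) _) (pow_nonneg ha n)
  have := smul_le_smul_of_nonneg_left hle (pow_nonneg ht0.le (k + 1))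
  rw [smul_smul, ← mul_pow, mul_inv_cancel₀ ht0.ne', one_pow, one_smul] at this
  refine this.trans_eq ?_
  rw [Function.comp_apply, sub_zero, pow_succ', mul_smul]
  congr 1
  rw [← Complex.coe_smul]; push_cast; rfl

theorem specRad_pos_of_irreducible (h1 : AxiomA1 A) {a : A} (ha0 : a ≠ 0)
    (hac : OrderContinuous a) (hai : IsIrreducible a) (hp : IsPole a (specRad a : ℂ)) :
    0 < specRad a := by
  refine lt_of_le_of_ne (specRad_nonneg a) fun h => ?_
  obtain ⟨k, hk⟩ := exists_pow_eq_zero_of_isPole_zero hac.1 h.symm (by simpa [← h] using hp)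
  exact pow_ne_zero_of_irreducible h1 hac hai ha0 k hk

/-- The coefficient of `1` vanishes as `t ↓ 1`, so dropping it does not change the limit, and `Aₙ`
is closed. -/
theorem orderContinuous_of_tendsto (h1 : AxiomA1 A) {b d : A} (hb : OrderContinuous b) {S : ℝ → A}
    {s : ℝ → ℕ → ℝ} (hs : ∀ t, 1 < t → ∀ n, 0 ≤ s t n)
    (hS : ∀ t, 1 < t → HasSum (fun n => s t n • b ^ n) (S t)) (hd : Tendsto S (𝓝[>] 1) (𝓝 d))
    (h0 : Tendsto (fun t => s t 0) (𝓝[>] 1) (𝓝 0)) : OrderContinuous d := by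
  have hlim : Tendsto (fun t => S t - s t 0 • (1 : A)) (𝓝[>] 1) (𝓝 d) := by
    simpa using hd.sub (h0.smul_const (1 : A))
  refine h1.closed.mem_of_tendsto hlim ?_
  filter_upwards [eventually_mem_nhdsWithin] with t ht
  exact orderContinuous_of_hasSum h1 hb (hs t ht) (hS t ht)

theorem abelMean_coeff_nonneg {t : ℝ} (ht : 1 < t) (n : ℕ) : 0 ≤ (t - 1) * (t⁻¹) ^ (n + 1) :=
  mul_nonneg (sub_pos.2 ht).le (pow_nonneg (inv_nonneg.2 (by linarith)) _)

theorem tendsto_abelMean_coeff_zero :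
    Tendsto (fun t : ℝ => (t - 1) * (t⁻¹) ^ (0 + 1)) (𝓝[>] 1) (𝓝 0) := by
  have ht1 : Tendsto (fun t : ℝ => t) (𝓝[>] (1 : ℝ)) (𝓝 1) := nhdsWithin_le_nhds
  simpa using tendsto_sub_one_zero.mul (ht1.inv₀ one_ne_zero)

/-- For an irreducible order continuous element of spectral radius `1`, a pole at `1` is simple and
its residue is an algebraically strictly positive order continuous idempotent. -/
theorem exists_simple_pole_expansion (h1 : AxiomA1 A) {b : A} (hb : OrderContinuous b)
    (hbi : IsIrreducible b) (hr : specRad b = 1) (hp : IsPole b 1) :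
    ∃ c : ℤ → A, IsLaurentExpansion b 1 c ∧ (∀ j : ℤ, j < -1 → c j = 0) ∧
      Tendsto (fun t : ℝ => abelMean b 1 t) (𝓝[>] 1) (𝓝 (c (-1))) ∧ OrderContinuous (c (-1)) ∧
      b * c (-1) = c (-1) ∧ c (-1) * b = c (-1) ∧ c (-1) * c (-1) = c (-1) ∧ c (-1) ≠ 0 ∧
      AlgStrictlyPos (c (-1)) := by
  obtain ⟨k, hk, -, c, hc, hc0, hck⟩ := hp
  obtain ⟨m, rfl⟩ := Nat.exists_eq_succ_of_ne_zero hk.ne'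
  have hlim := hc.tendsto_abelMean one_ne_zero hc0
  rw [inv_one, one_pow, one_smul] at hlim
  set d := c (-((m + 1 : ℕ) : ℤ)) with hd
  obtain ⟨hbd, hdb⟩ := eigenvector_of_tendsto_abelMean hr (by simp) hlim
  rw [one_smul] at hbd hdb
  have hdc : OrderContinuous d := by
    refine orderContinuous_of_tendsto h1 hb
      (s := fun t n => (t - 1) ^ m * ((t - 1) * (t⁻¹) ^ (n + 1)))
      (fun t ht n => mul_nonneg (pow_nonneg (by linarith) m) (abelMean_coeff_nonneg ht n))
      (fun t ht => ?_) hlim ?_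
    · simpa only [smul_smul] using (hasSum_abelMean_one hr ht).const_smul ((t - 1) ^ m)
    · simpa only [mul_zero] using (tendsto_sub_one_zero.pow m).mul tendsto_abelMean_coeff_zero
  have hdp : AlgStrictlyPos d := algStrictlyPos_of_fixed h1 hb hbi hdc hck hbd hdb
  -- The Abel means fix `d`, so their scaled versions act on it as `(t - 1)ᵐ`. For `m > 0` this
  -- would give `d² = 0`, against strict positivity.
  have hdd : Tendsto (fun t : ℝ => (t - 1) ^ m • d) (𝓝[>] 1) (𝓝 (d * d)) := by
    refine (hlim.mul_const d).congr' ?_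
    filter_upwards [eventually_mem_nhdsWithin] with t ht
    rw [smul_mul_assoc, abelMean_mul hr (by simp) ht (by rw [one_smul, hbd])]
  have hm : m = 0 := by
    by_contra hm
    have h0 : d * d = 0 := tendsto_nhds_unique hdd (by
      simpa [hm] using (tendsto_sub_one_zero.pow m).smul_const d)
    exact hck (eq_zero_of_mul_eq_zero_left h1 hdc hdp hdc h0)
  subst hm
  have hd' : d = c (-1) := by simp [hd]
  clear_value d
  clear hd
  subst hd'
  refine ⟨c, hc, by simpa using hc0, by simpa using hlim, hdc, hbd, hdb, ?_, hck, hdp⟩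
  exact tendsto_nhds_unique hdd (by simp)

end LeadingCoefficient

/-! ### Markov operators on `C(K)` -/

section MarkovOperators

variable {K : Type*} [TopologicalSpace K] [CompactSpace K]
  (S : C(K, ℝ) →ₗ[ℝ] C(K, ℝ))

/-- Jensen's inequality for squares, for a Markov operator. -/
theorem sq_markov_le (hS : ∀ f, 0 ≤ f → 0 ≤ S f) (h1 : S 1 = 1) (x : C(K, ℝ)) :
    S x * S x ≤ S (x * x) := by
  intro s
  -- The variance of `x` under the functional `f ↦ S f s` is non-negative.
  have h := hS ((x - (S x s) • 1) * (x - (S x s) • 1)) (fun k => mul_self_nonneg _) s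
  have e : (x - (S x s) • 1) * (x - (S x s) • 1) =
      x * x - (2 * S x s) • x + (S x s * S x s) • 1 := by
    ext k; simp; ring
  rw [e] at h
  simp [h1] at h
  change S x s * S x s ≤ S (x * x) s
  linarith

/-- The squared modulus of a unimodular eigenfunction of a Markov operator is superharmonic. -/
theorem sq_modulus_le_markov (hS : ∀ f, 0 ≤ f → 0 ≤ S f) (h1 : S 1 = 1) {x y : C(K, ℝ)} {α β : ℝ}
    (hαβ : α * α + β * β = 1) (hx : S x = α • x - β • y) (hy : S y = β • x + α • y) :
    x * x + y * y ≤ S (x * x + y * y) := by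
  have e : x * x + y * y = S x * S x + S y * S y := by
    rw [hx, hy]
    ext k
    simp
    linear_combination (-(x k * x k + y k * y k)) * hαβ
  rw [map_add]
  nth_rewrite 1 [e]
  exact add_le_add (sq_markov_le S hS h1 x) (sq_markov_le S hS h1 y)

/-- The square of an eigenfunction of constant modulus for a unimodular eigenvalue of a Markov
operator is an eigenfunction for the square of the eigenvalue. -/
theorem markov_sq_eigenfunction (hS : ∀ f, 0 ≤ f → 0 ≤ S f) (h1 : S 1 = 1) {x y : C(K, ℝ)}
    {α β t : ℝ} (hαβ : α * α + β * β = 1) (hx : S x = α • x - β • y) (hy : S y = β • x + α • y)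
    (ht : x * x + y * y = t • 1) :
    S (x * x - y * y) = (α * α - β * β) • (x * x - y * y) - (2 * α * β) • ((2 : ℝ) • (x * y)) ∧
    S ((2 : ℝ) • (x * y)) =
      (2 * α * β) • (x * x - y * y) + (α * α - β * β) • ((2 : ℝ) • (x * y)) := by
  -- Constant modulus forces equality in Jensen's inequality at every point, so `S` acts
  -- multiplicatively on the products of `x` and `y`.
  have key : ∀ s : K, S (x * x) s = (S x s) * (S x s) ∧ S (y * y) s = (S y s) * (S y s) ∧
      S (x * y) s = (S x s) * (S y s) := by
    intro s
    set u := S x s with hu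
    set v := S y s with hv
    have hts : x s * x s + y s * y s = t := by
      have := DFunLike.congr_fun ht s; simpa using this
    have huv : u * u + v * v = t := by
      rw [hu, hv, hx, hy]
      simp
      linear_combination hts + (x s * x s + y s * y s) * hαβ
    have hxx : u * u ≤ S (x * x) s := sq_markov_le S hS h1 x s
    have hyy : v * v ≤ S (y * y) s := sq_markov_le S hS h1 y s
    have hsum : S (x * x) s + S (y * y) s = t := by
      have := DFunLike.congr_fun (congrArg S ht) s
      simpa [h1] using this
    have e1 : S (x * x) s = u * u := by linarith
    have e2 : S (y * y) s = v * v := by linarith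
    refine ⟨e1, e2, ?_⟩
    -- Jensen for `x + y` and `x - y` bounds the mixed term from both sides.
    have hpos : ∀ σ : ℝ, σ * σ = 1 → 0 ≤ σ * (S (x * y) s - u * v) := by
      intro σ hσ
      have h : S (x + σ • y) s * S (x + σ • y) s ≤ S ((x + σ • y) * (x + σ • y)) s :=
        sq_markov_le S hS h1 (x + σ • y) s
      have e : (x + σ • y) * (x + σ • y) = x * x + (2 * σ) • (x * y) + (σ * σ) • (y * y) := by
        ext k; simp; ring
      rw [e] at h
      simp [e1, e2, ← hu, ← hv, hσ] at h
      nlinarith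
    have p1 := hpos 1 (by norm_num)
    have p2 := hpos (-1) (by norm_num)
    linarith
  constructor
  · ext s
    obtain ⟨e1, e2, e3⟩ := key s
    rw [map_sub, ContinuousMap.sub_apply, e1, e2, hx, hy]
    simp; ring
  · ext s
    obtain ⟨e1, e2, e3⟩ := key s
    rw [map_smul, ContinuousMap.smul_apply, e3, hx, hy]
    simp; ring

end MarkovOperators

/-! ### Regular elements and their real and imaginary parts -/

section Regular

variable {A : Type u} [NormedRing A] [NormedAlgebra ℂ A] [CompleteSpace A]
  [PartialOrder A] [IsOrderedRing A] [IsOrderedModule ℝ A] [OrderClosedTopology A]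

theorem add_mem_regularElements {x y : A} (hx : x ∈ regularElements A)
    (hy : y ∈ regularElements A) : x + y ∈ regularElements A := by
  obtain ⟨u, v, hu, hv, rfl⟩ := hx
  obtain ⟨u', v', hu', hv', rfl⟩ := hy
  exact ⟨u + u', v + v', add_nonneg hu hu', add_nonneg hv hv', by abel⟩

theorem smul_mem_regularElements {x : A} (hx : x ∈ regularElements A) (t : ℝ) :
    t • x ∈ regularElements A := by
  obtain ⟨u, v, hu, hv, rfl⟩ := hx
  rcases le_total 0 t with ht | ht
  · exact ⟨t • u, t • v, smul_nonneg ht hu, smul_nonneg ht hv, smul_sub _ _ _⟩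
  · exact ⟨(-t) • v, (-t) • u, smul_nonneg (neg_nonneg.2 ht) hv, smul_nonneg (neg_nonneg.2 ht) hu,
      by module⟩

theorem sub_mem_regularElements {x y : A} (hx : x ∈ regularElements A)
    (hy : y ∈ regularElements A) : x - y ∈ regularElements A := by
  have := add_mem_regularElements hx (smul_mem_regularElements hy (-1))
  rwa [neg_one_smul, ← sub_eq_add_neg] at this

theorem map_mem_regularElements {T : A →ₗ[ℂ] A} (hT : ∀ x, 0 ≤ x → 0 ≤ T x) {x : A}
    (hx : x ∈ regularElements A) : T x ∈ regularElements A := by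
  obtain ⟨u, v, hu, hv, rfl⟩ := hx
  exact ⟨T u, T v, hT u hu, hT v hv, map_sub _ _ _⟩

theorem orderIdeal_subset_regularElements {c : A} (hc : 0 ≤ c) (x : orderIdeal c) :
    (x : A) ∈ regularElements A := by
  obtain ⟨t, ht, hl, -⟩ := x.2
  exact mem_regularElements_of_le (smul_nonneg ht hc) hl

theorem map_real_smul (T : A →ₗ[ℂ] A) (t : ℝ) (x : A) : T (t • x) = t • T x := by
  rw [← Complex.coe_smul, map_smul, Complex.coe_smul]

/-- Real and imaginary part of an eigenvector equation. -/
theorem re_im_of_eigenvector (h4 : AxiomA4 A) {T : A →ₗ[ℂ] A} (hT : ∀ x, 0 ≤ x → 0 ≤ T x)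
    {x y : A} (hx : x ∈ regularElements A) (hy : y ∈ regularElements A) {ω : ℂ}
    (h : T (x + Complex.I • y) = ω • (x + Complex.I • y)) :
    T x = ω.re • x - ω.im • y ∧ T y = ω.im • x + ω.re • y := by
  have h1 := sub_mem_regularElements (map_mem_regularElements hT hx)
    (sub_mem_regularElements (smul_mem_regularElements hx ω.re) (smul_mem_regularElements hy ω.im))
  have h2 := sub_mem_regularElements (map_mem_regularElements hT hy)
    (add_mem_regularElements (smul_mem_regularElements hx ω.im) (smul_mem_regularElements hy ω.re))
  obtain ⟨e1, e2⟩ := h4 _ h1 _ h2 (by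
    have e : ω • (x + Complex.I • y) =
        (ω.re • x - ω.im • y) + Complex.I • (ω.im • x + ω.re • y) := by
      nth_rewrite 1 [← Complex.re_add_im ω]
      simp only [← Complex.coe_smul, add_smul, smul_add, smul_smul, add_mul]
      have : (ω.im : ℂ) * Complex.I * Complex.I = -ω.im := by
        rw [mul_assoc, Complex.I_mul_I]; ring
      rw [this, mul_comm Complex.I, mul_comm Complex.I]
      module
    rw [e, map_add, map_smul] at h
    rw [smul_sub, ← add_sub_add_comm, h, sub_self])
  exact ⟨sub_eq_zero.1 e1, sub_eq_zero.1 e2⟩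

end Regular

/-! ### Transfer between the order ideal and `C(K)` -/

section OrderIdealOperators

variable {A : Type u} [NormedRing A] [NormedAlgebra ℂ A] [CompleteSpace A]
  [PartialOrder A] [IsOrderedRing A] [IsOrderedModule ℝ A] [OrderClosedTopology A]
  {c : A} {K : Type u} [TopologicalSpace K] [CompactSpace K]

theorem map_mem_orderIdeal {T : A →ₗ[ℂ] A} (hT : ∀ x, 0 ≤ x → 0 ≤ T x) (hTc : T c = c) {x : A}
    (hx : x ∈ orderIdeal c) : T x ∈ orderIdeal c := by
  obtain ⟨t, ht, hl, hu⟩ := hx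
  have e : T (t • c) = t • c := by rw [map_real_smul, hTc]
  refine ⟨t, ht, ?_, ?_⟩
  · have := hT _ (neg_le_iff_add_nonneg.1 hl)
    rw [map_add, e] at this
    exact neg_le_iff_add_nonneg.2 this
  · have := hT _ (sub_nonneg.2 hu)
    rw [map_sub, e] at this
    exact sub_nonneg.1 this

/-- The operator on `C(K)` induced by an operator that leaves the order ideal invariant. -/
noncomputable def inducedOperator (φ : orderIdeal c ≃ₗ[ℝ] C(K, ℝ)) (T : A →ₗ[ℂ] A)
    (h : ∀ x ∈ orderIdeal c, T x ∈ orderIdeal c) : C(K, ℝ) →ₗ[ℝ] C(K, ℝ) :=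
  φ.toLinearMap ∘ₗ ((T.restrictScalars ℝ).restrict h) ∘ₗ φ.symm.toLinearMap

theorem inducedOperator_apply (φ : orderIdeal c ≃ₗ[ℝ] C(K, ℝ)) (T : A →ₗ[ℂ] A)
    (h : ∀ x ∈ orderIdeal c, T x ∈ orderIdeal c) (x : orderIdeal c) :
    inducedOperator φ T h (φ x) = φ ⟨T x, h x x.2⟩ := by
  simp only [inducedOperator, LinearMap.comp_apply, LinearEquiv.coe_coe, φ.symm_apply_apply]
  rfl

variable {φ : orderIdeal c ≃ₗ[ℝ] C(K, ℝ)}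

theorem inducedOperator_markov (hφ : ∀ x y : orderIdeal c, φ x ≤ φ y ↔ x ≤ y)
    (hφ1 : ((φ.symm 1 : orderIdeal c) : A) = c)
    {T : A →ₗ[ℂ] A} (hT : ∀ x, 0 ≤ x → 0 ≤ T x) (hTc : T c = c)
    (h : ∀ x ∈ orderIdeal c, T x ∈ orderIdeal c) :
    (∀ f, 0 ≤ f → 0 ≤ inducedOperator φ T h f) ∧ inducedOperator φ T h 1 = 1 := by
  constructor
  · intro f hf
    obtain ⟨x, rfl⟩ := φ.surjective f
    rw [inducedOperator_apply]
    rw [← map_zero φ, hφ] at hf ⊢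
    exact hT _ hf
  · obtain ⟨e, he⟩ : ∃ e, φ e = 1 := φ.surjective 1
    have hec : (e : A) = c := by
      have := hφ1
      rwa [← he, φ.symm_apply_apply] at this
    rw [← he, inducedOperator_apply]
    congr 1
    ext
    simp only [hec, hTc]

/-- `T` is kept general because both left and right multiplication by `b` are needed. -/
theorem sq_modulus_le_map (hφ : ∀ x y : orderIdeal c, φ x ≤ φ y ↔ x ≤ y)
    (hφ1 : ((φ.symm 1 : orderIdeal c) : A) = c)
    {T : A →ₗ[ℂ] A} (hT : ∀ x, 0 ≤ x → 0 ≤ T x) (hTc : T c = c)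
    {x y : orderIdeal c} {α β : ℝ} (hαβ : α * α + β * β = 1)
    (hx : T x = α • (x : A) - β • (y : A)) (hy : T y = β • (x : A) + α • (y : A)) :
    ((φ.symm (φ x * φ x + φ y * φ y) : orderIdeal c) : A) ≤
      T (φ.symm (φ x * φ x + φ y * φ y) : orderIdeal c) := by
  have h := fun x (hx : x ∈ orderIdeal c) => map_mem_orderIdeal hT hTc hx
  obtain ⟨hS, hS1⟩ := inducedOperator_markov hφ hφ1 hT hTc h
  have hx' : inducedOperator φ T h (φ x) = α • φ x - β • φ y := by
    rw [inducedOperator_apply, ← map_smul, ← map_smul, ← map_sub]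
    congr 1; ext; exact hx
  have hy' : inducedOperator φ T h (φ y) = β • φ x + α • φ y := by
    rw [inducedOperator_apply, ← map_smul, ← map_smul, ← map_add]
    congr 1; ext; exact hy
  have key := sq_modulus_le_markov _ hS hS1 hαβ hx' hy'
  obtain ⟨q, hq⟩ := φ.surjective (φ x * φ x + φ y * φ y)
  rw [← hq, inducedOperator_apply, hφ] at key
  rw [← hq, φ.symm_apply_apply]
  exact key

theorem map_sq_eigenvector (hφ : ∀ x y : orderIdeal c, φ x ≤ φ y ↔ x ≤ y)
    (hφ1 : ((φ.symm 1 : orderIdeal c) : A) = c)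
    {T : A →ₗ[ℂ] A} (hT : ∀ x, 0 ≤ x → 0 ≤ T x) (hTc : T c = c)
    {x y : orderIdeal c} {α β t : ℝ} (hαβ : α * α + β * β = 1)
    (hx : T x = α • (x : A) - β • (y : A)) (hy : T y = β • (x : A) + α • (y : A))
    (ht : φ x * φ x + φ y * φ y = t • 1) {X Y : orderIdeal c} (hX : φ X = φ x * φ x - φ y * φ y)
    (hY : φ Y = (2 : ℝ) • (φ x * φ y)) :
    T X = (α * α - β * β) • (X : A) - (2 * α * β) • (Y : A) ∧
      T Y = (2 * α * β) • (X : A) + (α * α - β * β) • (Y : A) := by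
  have h := fun x (hx : x ∈ orderIdeal c) => map_mem_orderIdeal hT hTc hx
  obtain ⟨hS, hS1⟩ := inducedOperator_markov hφ hφ1 hT hTc h
  have hx' : inducedOperator φ T h (φ x) = α • φ x - β • φ y := by
    rw [inducedOperator_apply, ← map_smul, ← map_smul, ← map_sub]
    congr 1; ext; exact hx
  have hy' : inducedOperator φ T h (φ y) = β • φ x + α • φ y := by
    rw [inducedOperator_apply, ← map_smul, ← map_smul, ← map_add]
    congr 1; ext; exact hy
  obtain ⟨k1, k2⟩ := markov_sq_eigenfunction _ hS hS1 hαβ hx' hy' ht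
  rw [← hX, ← hY, inducedOperator_apply, ← map_smul, ← map_smul, ← map_sub] at k1
  rw [← hX, ← hY, inducedOperator_apply, ← map_smul, ← map_smul, ← map_add] at k2
  exact ⟨congrArg Subtype.val (φ.injective k1), congrArg Subtype.val (φ.injective k2)⟩

end OrderIdealOperators

/-! ### Peripheral poles are roots of unity -/

section Peripheral

variable {A : Type u} [NormedRing A] [NormedAlgebra ℂ A] [CompleteSpace A]
  [PartialOrder A] [IsOrderedRing A] [IsOrderedModule ℝ A] [OrderClosedTopology A]

/-- The properties of the residue at `1` of an irreducible order continuous element of spectral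
radius `1`. -/
structure IsPerronResidue (b c : A) : Prop where
  tendsto : Tendsto (fun t : ℝ => abelMean b 1 t) (𝓝[>] 1) (𝓝 c)
  orderContinuous : OrderContinuous c
  mul_left : b * c = c
  mul_right : c * b = c
  idem : c * c = c
  ne_zero : c ≠ 0
  pos : AlgStrictlyPos c

/-- The Abel means at `ω` are dominated by those at `1`, which converge. An extra factor `(t - 1)ᵐ`
with `m > 0` would therefore annihilate the leading coefficient, so the pole is simple; with `m = 0`
the same domination puts both parts of `d` in `A_c`. -/
theorem exists_simple_peripheral_residue (h5 : AxiomA5 A) {b c : A} (hb : 0 ≤ b)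
    (hr : specRad b = 1) (hc : IsPerronResidue b c) {ω : ℂ} (hω : ‖ω‖ = 1) (hp : IsPole b ω) :
    ∃ d : A, d ≠ 0 ∧ Tendsto (fun t : ℝ => abelMean b ω t) (𝓝[>] 1) (𝓝 d) ∧
      b * d = ω • d ∧ d * b = ω • d ∧
      ∃ x y : A, d = x + Complex.I • y ∧ -c ≤ x ∧ x ≤ c ∧ -c ≤ y ∧ y ≤ c := by
  have hω0 : ω ≠ 0 := norm_ne_zero_iff.1 (by rw [hω]; exact one_ne_zero)
  obtain ⟨k, hk, -, e, he, he0, hek⟩ := hp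
  obtain ⟨m, rfl⟩ := Nat.exists_eq_succ_of_ne_zero hk.ne'
  have hlim := he.tendsto_abelMean hω0 he0
  set d := (ω⁻¹) ^ m • e (-((m + 1 : ℕ) : ℤ)) with hd
  have hd0 : d ≠ 0 := smul_ne_zero (pow_ne_zero _ (inv_ne_zero hω0)) hek
  have hm : m = 0 := by
    by_contra hm
    have hM : Tendsto (fun t : ℝ => (t - 1) ^ m • abelMean b 1 t) (𝓝[>] 1) (𝓝 0) := by
      simpa [hm] using (tendsto_sub_one_zero.pow m).smul hc.tendsto
    obtain ⟨x, y, h, hx1, hx2, hy1, hy2⟩ := exists_re_im_of_tendsto h5 hb hr hω hlim hM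
    rw [neg_zero] at hx1 hy1
    rw [le_antisymm hx2 hx1, le_antisymm hy2 hy1] at h
    exact hd0 (by simpa using h)
  clear_value d
  subst hm
  obtain ⟨h1, h2⟩ := eigenvector_of_tendsto_abelMean hr hω hlim
  exact ⟨d, hd0, by simpa using hlim, h1, h2,
    exists_re_im_of_tendsto h5 hb hr hω hlim (by simpa using hc.tendsto)⟩

theorem mem_spectrum_of_eigenvector {b z : A} {ξ : ℂ} (hz : z ≠ 0) (h : b * z = ξ • z) :
    ξ ∈ spectrum ℂ b := by
  intro hu
  apply hz
  have : (algebraMap ℂ A ξ - b) * z = 0 := by rw [sub_mul, h, ← Algebra.smul_def, sub_self]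
  exact (IsUnit.mul_right_eq_zero hu).1 this

/-- An element `q` of the order ideal of the residue with `q ≤ bq` and `q ≤ qb` is a multiple of
the residue. -/
theorem IsPerronResidue.eq_smul_of_le (h1 : AxiomA1 A) (h2 : AxiomA2 A) (h4 : AxiomA4 A) {b c : A}
    (hb : 0 ≤ b) (hr : specRad b = 1) (hc : IsPerronResidue b c) {q : A} (hq : q ∈ orderIdeal c)
    (hl : q ≤ b * q) (hr' : q ≤ q * b) : ∃ τ : ℝ, q = τ • c := by
  have hreg : q ∈ regularElements A :=
    orderIdeal_subset_regularElements hc.orderContinuous.1 ⟨q, hq⟩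
  have hcreg : c ∈ regularElements A := ⟨c, 0, hc.orderContinuous.1, le_rfl, by simp⟩
  obtain ⟨t, ht, hlo, hup⟩ := hq
  have hc0 := hc.orderContinuous.1
  -- Cancellation needs order continuity, obtained here by domination; the additional `c` only keeps
  -- the factor positive when `t = 0`.
  have bound : ∀ w, 0 ≤ w → ∀ v, v ≤ t • c → w = v - q → OrderContinuous w := by
    intro w hw v hv e
    refine hc.orderContinuous.of_le (t := 2 * t + 1) (by linarith) hw ?_
    calc w = v + -q := by rw [e, sub_eq_add_neg]
      _ ≤ t • c + t • c := add_le_add hv (neg_le.1 hlo)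
      _ ≤ t • c + t • c + c := le_add_of_nonneg_right hc0
      _ = (2 * t + 1) • c := by module
  -- `c(bq - q) = 0` because `cb = c`, and `c` can be cancelled.
  have hbq : b * q = q := by
    rw [← sub_eq_zero]
    refine eq_zero_of_mul_eq_zero_left h1 hc.orderContinuous hc.pos
      (bound _ (sub_nonneg.2 hl) _ ?_ rfl) ?_
    · have := mul_le_mul_of_nonneg_left hup hb
      rwa [mul_smul_comm, hc.mul_left] at this
    · rw [mul_sub, ← mul_assoc, hc.mul_right, sub_self]
  have hqb : q * b = q := by
    rw [← sub_eq_zero]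
    refine eq_zero_of_mul_eq_zero_right h1 hc.orderContinuous hc.pos
      (bound _ (sub_nonneg.2 hr') _ ?_ rfl) ?_
    · have := mul_le_mul_of_nonneg_right hup hb
      rwa [smul_mul_assoc, hc.mul_right] at this
    · rw [sub_mul, mul_assoc, hc.mul_left, sub_self]
  have hcq : c * q = q := by
    refine tendsto_nhds_unique (hc.tendsto.mul_const q) (tendsto_const_nhds.congr' ?_)
    filter_upwards [eventually_mem_nhdsWithin] with s hs
    rw [abelMean_mul hr (by simp) hs (by rw [one_smul, hbq])]
  have hqc : q * c = q := by
    refine tendsto_nhds_unique (hc.tendsto.const_mul q) (tendsto_const_nhds.congr' ?_)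
    filter_upwards [eventually_mem_nhdsWithin] with s hs
    rw [mul_abelMean hr (by simp) hs (by rw [one_smul, hqb])]
  -- Now `q = cqc` is a complex multiple of the minimal idempotent `c`; (A₄) removes the imaginary
  -- part of the scalar.
  obtain ⟨τ, hτ⟩ := (h2 c hc.idem hc.pos).2.2 q
  rw [hcq, hqc] at hτ
  refine ⟨τ.re, ?_⟩
  rw [← sub_eq_zero]
  refine (h4 _ (sub_mem_regularElements hreg (smul_mem_regularElements hcreg τ.re))
    _ (smul_mem_regularElements hcreg (-τ.im)) ?_).1
  rw [hτ]
  nth_rewrite 1 [← Complex.re_add_im τ]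
  simp only [← Complex.coe_smul, smul_smul, ← add_smul, ← sub_smul]
  convert zero_smul ℂ c
  push_cast; ring

/-- The square of a unimodular pole is a spectral value. -/
theorem IsPerronResidue.sq_mem_spectrum (h1 : AxiomA1 A) (h2 : AxiomA2 A) (h3 : AxiomA3 A)
    (h4 : AxiomA4 A) (h5 : AxiomA5 A) {b c : A} (hb : 0 ≤ b) (hr : specRad b = 1)
    (hc : IsPerronResidue b c) {ω : ℂ} (hω : ‖ω‖ = 1) (hp : IsPole b ω) :
    ω ^ 2 ∈ spectrum ℂ b := by
  obtain ⟨d, hd0, -, hbd, hdb, x', y', hd, hx1, hx2, hy1, hy2⟩ :=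
    exists_simple_peripheral_residue h5 hb hr hc hω hp
  have hc0 := hc.orderContinuous.1
  obtain ⟨K, _, _, _, φ, hφ, hφ1⟩ := h3 c hc0 hc.ne_zero
  obtain ⟨x, rfl⟩ : ∃ x : orderIdeal c, x' = x :=
    ⟨⟨x', 1, zero_le_one, by simpa using hx1, by simpa using hx2⟩, rfl⟩
  obtain ⟨y, rfl⟩ : ∃ y : orderIdeal c, y' = y :=
    ⟨⟨y', 1, zero_le_one, by simpa using hy1, by simpa using hy2⟩, rfl⟩
  have hxr := orderIdeal_subset_regularElements hc0 x
  have hyr := orderIdeal_subset_regularElements hc0 y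
  have hL : ∀ z : A, 0 ≤ z → 0 ≤ LinearMap.mulLeft ℂ b z := fun z hz => mul_nonneg hb hz
  have hR : ∀ z : A, 0 ≤ z → 0 ≤ LinearMap.mulRight ℂ b z := fun z hz => mul_nonneg hz hb
  have hLc : LinearMap.mulLeft ℂ b c = c := hc.mul_left
  have hRc : LinearMap.mulRight ℂ b c = c := hc.mul_right
  obtain ⟨hLx, hLy⟩ := re_im_of_eigenvector h4 hL hxr hyr (ω := ω) (by rw [← hd]; exact hbd)
  obtain ⟨hRx, hRy⟩ := re_im_of_eigenvector h4 hR hxr hyr (ω := ω) (by rw [← hd]; exact hdb)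
  have hαβ : ω.re * ω.re + ω.im * ω.im = 1 := by
    rw [← Complex.normSq_apply, Complex.normSq_eq_norm_sq, hω, one_pow]
  obtain ⟨τ, hτ⟩ := hc.eq_smul_of_le h1 h2 h4 hb hr
    (φ.symm (φ x * φ x + φ y * φ y)).2
    (sq_modulus_le_map hφ hφ1 hL hLc hαβ hLx hLy) (sq_modulus_le_map hφ hφ1 hR hRc hαβ hRx hRy)
  have hτ' : φ x * φ x + φ y * φ y = τ • 1 := by
    apply φ.symm.injective
    ext
    rw [hτ, map_smul, Submodule.coe_smul, hφ1]
  -- `X + iY` is the square of `x + iy` for the pointwise product of `C(K)`, not for the product of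
  -- `A`.
  obtain ⟨X, hX⟩ := φ.surjective (φ x * φ x - φ y * φ y)
  obtain ⟨Y, hY⟩ := φ.surjective ((2 : ℝ) • (φ x * φ y))
  obtain ⟨hTX, hTY⟩ := map_sq_eigenvector hφ hφ1 hL hLc hαβ hLx hLy hτ' hX hY
  simp only [LinearMap.mulLeft_apply] at hTX hTY
  refine mem_spectrum_of_eigenvector (z := (X : A) + Complex.I • (Y : A)) (fun h0 => ?_) ?_
  · obtain ⟨eX, eY⟩ := h4 _ (orderIdeal_subset_regularElements hc0 X) _
      (orderIdeal_subset_regularElements hc0 Y) h0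
    have eX' : X = 0 := Subtype.ext eX
    have eY' : Y = 0 := Subtype.ext eY
    rw [eX', map_zero] at hX
    rw [eY', map_zero] at hY
    have key : ∀ s, φ x s = 0 ∧ φ y s = 0 := by
      intro s
      have k1 : 0 = φ x s * φ x s - φ y s * φ y s := DFunLike.congr_fun hX s
      have k2 : 0 = 2 * (φ x s * φ y s) := DFunLike.congr_fun hY s
      -- The squared modulus of the square is the square of the squared modulus, so a zero square
      -- forces `x = y = 0`.
      have k3 : (φ x s * φ x s + φ y s * φ y s) ^ 2 = 0 := by
        linear_combination (-(φ x s * φ x s - φ y s * φ y s)) * k1 - (2 * (φ x s * φ y s)) * k2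
      have k4 := pow_eq_zero_iff (two_ne_zero) |>.1 k3
      constructor <;> nlinarith [mul_self_nonneg (φ x s), mul_self_nonneg (φ y s)]
    have hx0 : x = 0 := φ.injective (by rw [map_zero]; ext s; exact (key s).1)
    have hy0 : y = 0 := φ.injective (by rw [map_zero]; ext s; exact (key s).2)
    apply hd0
    rw [hd, hx0, hy0]; simp
  · have hω2 : ω ^ 2 = ((ω.re * ω.re - ω.im * ω.im : ℝ) : ℂ) +
        ((2 * ω.re * ω.im : ℝ) : ℂ) * Complex.I := by
      nth_rewrite 1 [← Complex.re_add_im ω]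
      push_cast
      linear_combination ((ω.im : ℂ) ^ 2) * Complex.I_mul_I
    rw [mul_add, mul_smul_comm, hTX, hTY, hω2]
    simp only [← Complex.coe_smul, smul_add, add_smul, smul_smul, add_mul]
    have e : ((2 * ω.re * ω.im : ℝ) : ℂ) * Complex.I * Complex.I = -((2 * ω.re * ω.im : ℝ) : ℂ) := by
      rw [mul_assoc, Complex.I_mul_I]; ring
    rw [e, mul_comm Complex.I, mul_comm Complex.I]
    module

/-- Poles are isolated in the spectrum, and the peripheral spectrum is compact. -/
theorem finite_peripheralSpectrum {b : A} (h : ∀ z ∈ peripheralSpectrum b, IsPole b z) :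
    (peripheralSpectrum b).Finite := by
  have hcomp : IsCompact (peripheralSpectrum b) := by
    have : peripheralSpectrum b = spectrum ℂ b ∩ {z | ‖z‖ = specRad b} := rfl
    rw [this]
    exact (spectrum.isCompact b).inter_right (isClosed_eq continuous_norm continuous_const)
  refine hcomp.finite (IsDiscrete.of_nhdsWithin fun z hz => ?_)
  obtain ⟨k, -, -, c, ⟨ε, hε, hc⟩, -⟩ := h z hz
  rw [le_pure_iff]
  refine mem_nhdsWithin.2 ⟨Metric.ball z ε, Metric.isOpen_ball, Metric.mem_ball_self hε, ?_⟩
  rintro w ⟨hw, hws⟩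
  by_contra hne
  rw [Metric.mem_ball, dist_eq_norm] at hw
  exact hws.1 (hc w (norm_pos_iff.2 (sub_ne_zero.2 hne)) hw).1

/-- Peripheral spectral values are roots of unity. -/
theorem IsPerronResidue.exists_pow_eq_one (h1 : AxiomA1 A) (h2 : AxiomA2 A) (h3 : AxiomA3 A)
    (h4 : AxiomA4 A) (h5 : AxiomA5 A) {b c : A} (hb : 0 ≤ b) (hr : specRad b = 1)
    (hc : IsPerronResidue b c) (hper : ∀ z ∈ peripheralSpectrum b, IsPole b z) {ω : ℂ}
    (hω : ω ∈ peripheralSpectrum b) : ∃ n : ℕ, 0 < n ∧ ω ^ n = 1 := by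
  -- Only squaring is available, but the orbit of `ω` under it must repeat in a finite set, which
  -- suffices.
  have hmem : ∀ n : ℕ, ω ^ (2 ^ n) ∈ peripheralSpectrum b := by
    intro n
    induction n with
    | zero => simpa using hω
    | succ n ih =>
      have hn : ‖ω ^ (2 ^ n)‖ = 1 := ih.2.trans hr
      rw [pow_succ, pow_mul]
      refine ⟨hc.sq_mem_spectrum h1 h2 h3 h4 h5 hb hr hn (hper _ ih), ?_⟩
      rw [norm_pow, hn, hr, one_pow]
  have hω0 : ω ≠ 0 := norm_ne_zero_iff.1 (by rw [hω.2, hr]; exact one_ne_zero)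
  have hninj : ¬ Function.Injective fun n : ℕ => ω ^ (2 ^ n) := fun hinj =>
    Set.infinite_of_injective_forall_mem hinj hmem (finite_peripheralSpectrum hper)
  obtain ⟨m, n, he, hmn⟩ : ∃ m n : ℕ, ω ^ (2 ^ m) = ω ^ (2 ^ n) ∧ m < n := by
    simp only [Function.Injective, not_forall] at hninj
    obtain ⟨m, n, he, hne⟩ := hninj
    rcases lt_or_gt_of_ne hne with h | h
    · exact ⟨m, n, he, h⟩
    · exact ⟨n, m, he.symm, h⟩
  have hlt : 2 ^ m < 2 ^ n := Nat.pow_lt_pow_right (by norm_num) hmn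
  refine ⟨2 ^ n - 2 ^ m, by omega, ?_⟩
  have : ω ^ (2 ^ m) * ω ^ (2 ^ n - 2 ^ m) = ω ^ (2 ^ m) * 1 := by
    rw [← pow_add, Nat.add_sub_cancel' hlt.le, mul_one, he]
  exact mul_left_cancel₀ (pow_ne_zero _ hω0) this

end Peripheral

/-! ### Irreducible powers, primitivity and convergence -/

section Primitivity

variable {A : Type u} [NormedRing A] [NormedAlgebra ℂ A] [CompleteSpace A] [Nontrivial A]
  [PartialOrder A] [IsOrderedRing A] [IsOrderedModule ℝ A] [OrderClosedTopology A]

theorem pow_mul_eigenvector {b d : A} {ξ : ℂ} (h : b * d = ξ • d) (n : ℕ) :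
    b ^ n * d = ξ ^ n • d := by
  induction n with
  | zero => simp
  | succ n ih => rw [pow_succ, mul_assoc, h, mul_smul_comm, ih, smul_smul, pow_succ']

theorem eigenvector_mul_pow {b d : A} {ξ : ℂ} (h : d * b = ξ • d) (n : ℕ) :
    d * b ^ n = ξ ^ n • d := by
  induction n with
  | zero => simp
  | succ n ih => rw [pow_succ, ← mul_assoc, ih, smul_mul_assoc, h, smul_smul, pow_succ]

theorem geom_sum_of_pow_eq_one {x : ℂ} {h : ℕ} (hx : x ^ h = 1) :
    ∑ i ∈ Finset.range h, x ^ i = ((if x = 1 then (h : ℝ) else 0 : ℝ) : ℂ) := by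
  split_ifs with h1
  · simp [h1]
  · rw [geom_sum_eq h1, hx]; simp

/-- If all powers of `b` are irreducible, then `1` is the only peripheral spectral value. -/
theorem IsPerronResidue.eq_one_of_irreducible_pow (h1 : AxiomA1 A) (h2 : AxiomA2 A)
    (h3 : AxiomA3 A) (h4 : AxiomA4 A) (h5 : AxiomA5 A) {b c : A} (hb : OrderContinuous b)
    (hr : specRad b = 1) (hc : IsPerronResidue b c)
    (hper : ∀ z ∈ peripheralSpectrum b, IsPole b z)
    (hirr : ∀ m : ℕ, 1 ≤ m → IsIrreducible (b ^ m)) {ω : ℂ} (hω : ω ∈ peripheralSpectrum b) :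
    ω = 1 := by
  by_contra hne
  obtain ⟨n, hn, hωn⟩ := hc.exists_pow_eq_one h1 h2 h3 h4 h5 hb.1 hr hper hω
  have hω1 : ‖ω‖ = 1 := hω.2.trans hr
  have hω0 : ω ≠ 0 := norm_ne_zero_iff.1 (by rw [hω1]; exact one_ne_zero)
  set h := orderOf ω with hh
  have hpos : 0 < h := orderOf_pos_iff.2 (isOfFinOrder_iff_pow_eq_one.2 ⟨n, hn, hωn⟩)
  have hωh : ω ^ h = 1 := pow_orderOf_eq_one ω
  have hlt : 1 < h := by
    rcases Nat.lt_or_ge 1 h with h' | h'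
    · exact h'
    · exact absurd (orderOf_eq_one_iff.1 (le_antisymm h' hpos)) hne
  have hnorm : ∀ i : ℕ, ‖ω ^ i‖ = 1 := fun i => by rw [norm_pow, hω1, one_pow]
  -- Not every `ωⁱ` is known to be spectral; at a regular point the limit is `0`, which is harmless
  -- in the sum below.
  have hex : ∀ i : ℕ, ∃ d : A, Tendsto (fun t : ℝ => abelMean b (ω ^ i) t) (𝓝[>] 1) (𝓝 d) := by
    intro i
    by_cases hi : ω ^ i ∈ spectrum ℂ b
    · obtain ⟨d, -, hd, -⟩ := exists_simple_peripheral_residue h5 hb.1 hr hc (hnorm i)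
        (hper _ ⟨hi, (hnorm i).trans hr.symm⟩)
      exact ⟨d, hd⟩
    · exact ⟨0, tendsto_abelMean_of_mem_resolventSet (pow_ne_zero _ hω0) (not_not.1 hi)⟩
  choose d hd using hex
  have heig := fun i => eigenvector_of_tendsto_abelMean (m := 0) hr (hnorm i) (by simpa using hd i)
  have hd0 : d 0 = c := tendsto_nhds_unique (hd 0) (by simpa using hc.tendsto)
  have hd1 : d 1 ≠ 0 := by
    obtain ⟨e, he0, he, -⟩ := exists_simple_peripheral_residue h5 hb.1 hr hc hω1 (hper _ hω)
    rwa [tendsto_nhds_unique (hd 1) (by simpa using he)]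
  have hidem : ∀ i, d i * d i = d i := fun i => by
    refine tendsto_nhds_unique ((hd i).mul_const (d i)) (tendsto_const_nhds.congr' ?_)
    filter_upwards [eventually_mem_nhdsWithin] with t ht
    rw [abelMean_mul hr (hnorm i) ht (heig i).1]
  have horth : ∀ i < h, ∀ j < h, i ≠ j → d i * d j = 0 := by
    intro i hi j hj hij
    have e : (ω ^ i - ω ^ j) • (d i * d j) = 0 := by
      rw [sub_smul, ← smul_mul_assoc, ← (heig i).2, ← mul_smul_comm, ← (heig j).1, mul_assoc,
        sub_self]
    refine (smul_eq_zero.1 e).resolve_left (sub_ne_zero.2 fun he => hij ?_)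
    exact pow_injOn_Iio_orderOf hi hj he
  set p := ∑ i ∈ Finset.range h, d i with hp
  have hpd : ∀ j < h, p * d j = d j := fun j hj => by
    rw [hp, Finset.sum_mul, Finset.sum_eq_single j, hidem]
    · exact fun i hi hij => horth i (Finset.mem_range.1 hi) j hj hij
    · exact fun hj' => absurd (Finset.mem_range.2 hj) hj'
  have hdp : ∀ j < h, d j * p = d j := fun j hj => by
    rw [hp, Finset.mul_sum, Finset.sum_eq_single j, hidem]
    · exact fun i hi hij => horth j hj i (Finset.mem_range.1 hi) hij.symm
    · exact fun hj' => absurd (Finset.mem_range.2 hj) hj'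
  have hpp : p * p = p := by
    conv_lhs => rw [hp, Finset.sum_mul]
    exact Finset.sum_congr rfl fun i hi => hdp i (Finset.mem_range.1 hi)
  have hbp : b ^ h * p = p := by
    rw [hp, Finset.mul_sum]
    refine Finset.sum_congr rfl fun i _ => ?_
    rw [pow_mul_eigenvector (heig i).1, pow_right_comm, hωh, one_pow, one_smul]
  have hpb : p * b ^ h = p := by
    rw [hp, Finset.sum_mul]
    refine Finset.sum_congr rfl fun i _ => ?_
    rw [eigenvector_mul_pow (heig i).2, pow_right_comm, hωh, one_pow, one_smul]
  have hp0 : p ≠ 0 := fun h0 => hd1 (by rw [← hpd 1 hlt, h0, zero_mul])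
  -- Summing `ω⁻ⁱⁿ` over `i < h` gives `h` if `ωⁿ = 1` and `0` otherwise, so the summed Abel means
  -- have non-negative coefficients although the individual ones need not.
  have hpoc : OrderContinuous p := by
    refine orderContinuous_of_tendsto h1 hb
      (S := fun t => ∑ i ∈ Finset.range h, abelMean b (ω ^ i) t)
      (s := fun t n => (t - 1) * (t⁻¹) ^ (n + 1) * (if (ω⁻¹) ^ n = 1 then (h : ℝ) else 0))
      (fun t ht n => mul_nonneg (abelMean_coeff_nonneg ht n) (by split_ifs <;> positivity))
      (fun t ht => ?_) (tendsto_finsetSum _ fun i _ => hd i) ?_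
    · refine (hasSum_congr fun n => ?_).2
        (hasSum_sum fun i (_ : i ∈ Finset.range h) => hasSum_abelMean hr (hnorm i) ht)
      have e : ∀ i : ℕ, ((ω ^ i)⁻¹) ^ n = ((ω⁻¹) ^ n) ^ i := fun i => by
        rw [← inv_pow, pow_right_comm]
      rw [← Finset.smul_sum, ← Finset.sum_smul, mul_smul]
      simp_rw [e]
      rw [geom_sum_of_pow_eq_one (by rw [pow_right_comm, inv_pow, hωh]; simp), Complex.coe_smul]
    · simpa using tendsto_abelMean_coeff_zero.mul_const (h : ℝ)
  have hpirr := hirr h hpos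
  have hppos := algStrictlyPos_of_fixed h1 (hb.pow h1 hpos.ne') hpirr hpoc hp0 hbp hpb
  -- Minimality makes `d 0` and `d 1` multiples of `p`; non-zero multiples of an idempotent cannot
  -- be orthogonal.
  have hmin := (h2 p hpp hppos).2.2
  obtain ⟨s, hs⟩ := hmin (d 0)
  obtain ⟨t, ht⟩ := hmin (d 1)
  rw [hpd _ hpos, hdp _ hpos] at hs
  rw [hpd _ hlt, hdp _ hlt] at ht
  have h01 := horth 0 hpos 1 hlt zero_ne_one
  rw [hs, ht, smul_mul_smul_comm, hpp] at h01
  rcases smul_eq_zero.1 h01 with h' | h'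
  · rcases mul_eq_zero.1 h' with h'' | h''
    · exact hc.ne_zero (by rw [← hd0, hs, h'', zero_smul])
    · exact hd1 (by rw [ht, h'', zero_smul])
  · exact hp0 h'

/-- All powers of an element whose normalised powers converge to an algebraically strictly positive
element are irreducible. -/
theorem isIrreducible_pow_of_tendsto {a L : A} (ha : 0 ≤ a) {r : ℝ} (hL : AlgStrictlyPos L)
    (h : Tendsto (fun n : ℕ => (r⁻¹ • a) ^ n) atTop (𝓝 L)) {m : ℕ} (hm : 1 ≤ m) :
    IsIrreducible (a ^ m) := by
  refine ⟨pow_nonneg ha m, fun p hp hpa => ?_⟩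
  have e1 : a ^ m * p = p * a ^ m * p := by
    rw [sub_mul, sub_mul, one_mul, sub_eq_zero] at hpa; exact hpa
  -- Invariance passes to all powers of `aᵐ`, hence to the limit `L`, where strict positivity
  -- excludes non-trivial `p`.
  have e2 : ∀ n : ℕ, (1 - p) * a ^ (m * n) * p = 0 := by
    intro n
    induction n with
    | zero => simp [sub_mul, hp.2.2]
    | succ n ih =>
      rw [mul_add, mul_one, pow_add, mul_assoc, mul_assoc, e1, mul_assoc p, ← mul_assoc (a ^ (m * n)),
        ← mul_assoc (1 - p), ← mul_assoc (1 - p), ih, zero_mul]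
  have hlim : Tendsto (fun n : ℕ => (1 - p) * (r⁻¹ • a) ^ (m * n) * p) atTop
      (𝓝 ((1 - p) * L * p)) :=
    ((h.comp (tendsto_id.const_mul_atTop' hm)).const_mul _).mul_const _
  have e3 : (1 - p) * L * p = 0 := by
    refine tendsto_nhds_unique hlim ?_
    simp only [smul_pow, mul_smul_comm, smul_mul_assoc, e2, smul_zero]
    exact tendsto_const_nhds
  by_contra hcon
  rw [not_or] at hcon
  have hpp := lt_of_le_of_ne hp.1 (Ne.symm hcon.1)
  have hpp' := lt_of_le_of_ne (one_sub_mem_OI hp).1 fun h => hcon.2 (sub_eq_zero.1 h.symm).symm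
  exact absurd (hL _ (one_sub_mem_OI hp) _ hp hpp' hpp) (by rw [e3]; exact lt_irrefl _)

theorem isPrimitive_of_tendsto {a L : A} (hr : 0 < specRad a)
    (h : Tendsto (fun n : ℕ => ((specRad a)⁻¹ • a) ^ n) atTop (𝓝 L)) : IsPrimitive a := by
  have hr0 : (((specRad a)⁻¹ : ℝ) : ℂ) ≠ 0 := Complex.ofReal_ne_zero.2 (inv_ne_zero hr.ne')
  have key : ∀ z ∈ peripheralSpectrum a, (((specRad a)⁻¹ : ℝ) : ℂ) * z = 1 := fun z hz => by
    refine eq_one_of_tendsto_pow (b := (((specRad a)⁻¹ : ℝ) : ℂ) • a) (L := L)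
      (by simpa only [Complex.coe_smul] using h)
      ((mem_spectrum_smul_iff hr0).2 hz.1) ?_
    rw [norm_mul, hz.2, Complex.norm_real, Real.norm_eq_abs, abs_of_pos (inv_pos.2 hr),
      inv_mul_cancel₀ hr.ne']
  intro z hz w hw
  exact mul_left_cancel₀ hr0 ((key z hz).trans (key w hw).symm)

theorem isPrimitive_pow_of_tendsto {a L : A} (hr : 0 < specRad a)
    (h : Tendsto (fun n : ℕ => ((specRad a)⁻¹ • a) ^ n) atTop (𝓝 L)) {m : ℕ} (hm : 1 ≤ m) :
    IsPrimitive (a ^ m) := by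
  refine isPrimitive_of_tendsto (L := L) (by rw [specRad_pow]; positivity) ?_
  refine (h.comp (tendsto_id.const_mul_atTop' hm)).congr fun n => ?_
  simp only [Function.comp_apply, id, pow_mul, specRad_pow, smul_pow, inv_pow]

end Primitivity

end OBA

/-! ### The equivalences for the normalised element -/

theorem theorem25 {A : Type*} [NormedRing A] [NormedAlgebra ℂ A] [CompleteSpace A] [Nontrivial A]
    [PartialOrder A] [IsOrderedRing A] [IsOrderedModule ℝ A] [OrderClosedTopology A]
    (h1 : OBA.AxiomA1 A) (h2 : OBA.AxiomA2 A) (h3 : OBA.AxiomA3 A) (h4 : OBA.AxiomA4 A)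
    (h5 : OBA.AxiomA5 A) (hLS : OBA.AxiomLS A)
    (a : A) (ha0 : a ≠ 0) (hac : OBA.OrderContinuous a) (hai : OBA.IsIrreducible a)
    (hpole : OBA.IsPole a (OBA.specRad a : ℂ)) :
    0 < OBA.specRad a ∧
    List.TFAE [
      OBA.IsPrimitive a,
      ∀ m : ℕ, 1 ≤ m → OBA.IsPrimitive (a ^ m),
      ∀ m : ℕ, 1 ≤ m → OBA.IsIrreducible (a ^ m),
      ∃ L : A, OBA.AlgStrictlyPos L ∧
        Tendsto (fun n : ℕ => ((OBA.specRad a)⁻¹ • a) ^ n) atTop (𝓝 L)] := by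
  have hr := OBA.specRad_pos_of_irreducible h1 ha0 hac hai hpole
  refine ⟨hr, ?_⟩
  have hr0 : (((OBA.specRad a)⁻¹ : ℝ) : ℂ) ≠ 0 := Complex.ofReal_ne_zero.2 (inv_ne_zero hr.ne')
  set b : A := (OBA.specRad a)⁻¹ • a with hb
  have hb' : b = (((OBA.specRad a)⁻¹ : ℝ) : ℂ) • a := by rw [hb, Complex.coe_smul]
  have hbr : OBA.specRad b = 1 := by
    rw [hb', OBA.specRad_smul a hr0, Complex.norm_real, Real.norm_eq_abs,
      abs_of_pos (inv_pos.2 hr), inv_mul_cancel₀ hr.ne']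
  have hbc : OBA.OrderContinuous b := hac.smul (inv_pos.2 hr).le
  have hbirr : ∀ m : ℕ, OBA.IsIrreducible (a ^ m) → OBA.IsIrreducible (b ^ m) := by
    intro m hm
    refine ⟨pow_nonneg hbc.1 m, fun p hp hpb => hm.2 p hp ?_⟩
    rw [hb, smul_pow, mul_smul_comm, smul_mul_assoc] at hpb
    exact (smul_eq_zero.1 hpb).resolve_left (pow_ne_zero _ (inv_ne_zero hr.ne'))
  have hbp : OBA.IsPole b 1 := by
    have := hpole.smul hr0
    rwa [← hb', ← Complex.ofReal_mul, inv_mul_cancel₀ hr.ne', Complex.ofReal_one] at this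
  obtain ⟨c, hexp, hc0, hlim, hcoc, hbcc, hcb, hcc, hcne, hcpos⟩ :=
    OBA.exists_simple_pole_expansion h1 hbc (by simpa using hbirr 1 (by simpa using hai)) hbr hbp
  -- The residue is itself a generator of the finite-rank ideal, with `q = 1`, so (A_LS) applies.
  have hper : ∀ z ∈ OBA.peripheralSpectrum b, OBA.IsPole b z := by
    refine hLS b hbc.1 (by simpa [hbr] using hbp) ⟨c (-1), ?_, c, by simpa [hbr] using hexp, rfl⟩
    have hmem : c (-1) ∈ OBA.basicProjectors A := by
      refine ⟨hcc, hcoc, 1, OBA.one_mem_OI, one_ne_zero, by simp, fun p hp q hq hp0 _ hq0 _ => ?_⟩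
      exact hcpos p hp q hq hp0 hq0
    exact ⟨⟨_, hmem⟩, TwoSidedIdeal.subset_span hmem⟩
  tfae_have 1 → 4 := by
    intro hprim
    refine ⟨c (-1), hcpos, OBA.tendsto_pow_of_simple_pole hbr hexp hc0 hbcc hcb hcc ?_⟩
    intro z hz
    obtain ⟨v, rfl⟩ : ∃ v, z = (((OBA.specRad a)⁻¹ : ℝ) : ℂ) * v :=
      ⟨((((OBA.specRad a)⁻¹ : ℝ) : ℂ))⁻¹ * z, by rw [mul_inv_cancel_left₀ hr0]⟩
    rw [hb'] at hz
    have hv := (OBA.mem_peripheralSpectrum_smul_iff hr0).1 hz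
    obtain ⟨k, -, hsp, -⟩ := hpole
    rw [hprim hv ⟨hsp, by rw [Complex.norm_real, Real.norm_eq_abs, abs_of_pos hr]⟩,
      ← Complex.ofReal_mul, inv_mul_cancel₀ hr.ne', Complex.ofReal_one]
  tfae_have 4 → 2 := fun ⟨L, _, hL⟩ m hm => OBA.isPrimitive_pow_of_tendsto hr hL hm
  tfae_have 2 → 1 := fun h => by simpa using h 1 le_rfl
  tfae_have 4 → 3 := fun ⟨L, hLp, hL⟩ m hm => OBA.isIrreducible_pow_of_tendsto hac.1 hLp hL hm
  tfae_have 3 → 1 := by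
    intro hirr
    have key : ∀ z ∈ OBA.peripheralSpectrum a, (((OBA.specRad a)⁻¹ : ℝ) : ℂ) * z = 1 :=
      fun z hz => by
        refine OBA.IsPerronResidue.eq_one_of_irreducible_pow h1 h2 h3 h4 h5 hbc hbr
          ⟨hlim, hcoc, hbcc, hcb, hcc, hcne, hcpos⟩ hper (fun m hm => hbirr m (hirr m hm)) ?_
        rw [hb']
        exact (OBA.mem_peripheralSpectrum_smul_iff hr0).2 hz
    intro z hz w hw
    exact mul_left_cancel₀ hr0 ((key z hz).trans (key w hw).symm)
  tfae_finish
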